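/- Let $d\ge 1$, let $Y=(0,1)^d$ be the unit cell, and let $D\subset Y$ be a nonempty open set. All functions are complex valued. Let $L^2_0(Y)=\{u\in L^2(Y):\int_Y u\,dx=0\}$, $(u,v)=\int_Y u\bar v\,dx$, $\mathcal H=\{u\in H^1(Y):\int_Y u\,dx=0\}$ and $\langle u,v\rangle=\int_Y\nabla u\cdot\nabla\bar v\,dx$. For $f\in L^2_0(Y)$ let $(-\Delta_N)^{-1}f$ be the element $w\in\mathcal H$ with $\langle w,v\rangle=(f,v)$ for all $v\in\mathcal H$. Let $$W_2=\Bigl\{\tilde u-\Bigl(\int_D\tilde u\,dx\Bigr)1_Y:\ \tilde u \text{ is the extension by zero to } Y \text{ of an element of } H^1_0(D)\Bigr\}\subset\mathcal H,$$ and let $P_2$ be the orthogonal projection of $\mathcal H$ onto $W_2$ with respect to $\langle\cdot,\cdot\rangle$. Then $A(0)=P_2(-\Delta_N)^{-1}$ is a well-defined bounded linear operator on $L^2_0(Y)$. Moreover $L^2(D)$ has a complete orthonormal system of Dirichlet eigenfunctions of $-\Delta$ on $D$, that is, of nonzero $\psi\in H^1_0(D)$ with $\int_D\nabla\psi\cdot\nabla\bar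 v\,dx=\delta\int_D\psi\bar v\,dx$ for all $v\in H^1_0(D)$, where $\delta\in\mathbb R$ is the eigenvalue. Let $(\psi_i)_{i\in\mathbb N}$ be any such system, with eigenvalues $(\delta_i)_{i\in\mathbb N}$. Put $a_i=|\int_D\psi_i\,dx|$, $I=\{i: a_i\neq 0\}$, $\delta_i^*=\delta_i$ for $i\in I$, and $$S(\nu)=\nu\sum_{i\in I}\frac{a_i^2}{\nu-\delta_i^*}-1,\qquad \nu\in\mathbb R\setminus\{\delta_i^*: i\in I\}.$$ Let $\Sigma'$ be the set of Dirichlet eigenvalues $\delta'$ of $-\Delta$ on $D$ that have at least one eigenfunction with mean zero over $D$, and let $N$ be the set of positive roots of $S$ (none of which is a pole $\delta_i^*$). Then $$\sigma(A(0))=\{0\}\cup\{1/\delta':\delta'\in\Sigma'\}\cup\{1/\nu:\nu\in N\},$$ or equivalently, $0\in\sigma(A(0))$ and the nonzero part of $\sigma(A(0))$ is the set of reciprocals of the elements of $\Sigma'\cup N$. -/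

import Mathlib

open MeasureTheory
open scoped ComplexConjugate ContDiff

noncomputable section

/-- The unit period cell `Y = (0,1)^d`. -/
def unitCell (d : ℕ) : Set (EuclideanSpace ℝ (Fin d)) :=
  {x | ∀ i, 0 < x i ∧ x i < 1}

lemma isFiniteMeasure_unitCell (d : ℕ) :
    IsFiniteMeasure (volume.restrict (unitCell d)) := by
  refine ⟨?_⟩
  rw [Measure.restrict_apply_univ]
  have h : Bornology.IsBounded (unitCell d) := by
    refine (Metric.isBounded_closedBall (x := (0 : EuclideanSpace ℝ (Fin d)))
      (r := Real.sqrt d)).subset ?_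
    intro x hx
    rw [mem_closedBall_zero_iff, EuclideanSpace.norm_eq]
    apply Real.sqrt_le_sqrt
    calc ∑ i, ‖x i‖ ^ 2 ≤ ∑ _i : Fin d, (1 : ℝ) := by
          apply Finset.sum_le_sum
          intro i _
          have := hx i
          rw [Real.norm_eq_abs, sq_abs]
          nlinarith
      _ = d := by simp
  exact h.measure_lt_top

/-- `L²(U)`, complex valued. -/
abbrev L2 {d : ℕ} (U : Set (EuclideanSpace ℝ (Fin d))) : Type :=
  Lp ℂ 2 (volume.restrict U)

/-- Pairs `(u, g)` of a function `u ∈ L²(U)` and a vector field `g ∈ L²(U)^d`.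
Sobolev functions are represented as pairs `(u, ∇u)`. -/
abbrev Jet {d : ℕ} (U : Set (EuclideanSpace ℝ (Fin d))) : Type :=
  L2 U × (Fin d → L2 U)

/-- `φ ∈ C_c^∞(U)`, complex valued. -/
def IsTestFunction {d : ℕ} (U : Set (EuclideanSpace ℝ (Fin d)))
    (φ : EuclideanSpace ℝ (Fin d) → ℂ) : Prop :=
  ContDiff ℝ ∞ φ ∧ HasCompactSupport φ ∧ tsupport φ ⊆ U

/-- The classical partial derivative `∂ᵢφ`. -/
def partialDeriv {d : ℕ} (i : Fin d) (φ : EuclideanSpace ℝ (Fin d) → ℂ) :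
    EuclideanSpace ℝ (Fin d) → ℂ :=
  fun x => fderiv ℝ φ x (EuclideanSpace.single i 1)

/-- `H¹(U)`: the pairs `(u, g)` such that `g` is the weak gradient of `u` in `U`. -/
def H1 {d : ℕ} (U : Set (EuclideanSpace ℝ (Fin d))) : Set (Jet U) :=
  {p | ∀ i, ∀ φ, IsTestFunction U φ →
    ∫ x in U, p.1 x * partialDeriv i φ x = - ∫ x in U, p.2 i x * φ x}

/-- `H¹₀(U)`: the closure of the pairs `(φ, ∇φ)`, `φ ∈ C_c^∞(U)`, in `L²(U) × L²(U)^d`,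
that is, the closure of `C_c^∞(U)` in `H¹(U)`. -/
def H10 {d : ℕ} (U : Set (EuclideanSpace ℝ (Fin d))) : Set (Jet U) :=
  closure {p | ∃ φ, IsTestFunction U φ ∧ p.1 =ᵐ[volume.restrict U] φ ∧
    ∀ i, p.2 i =ᵐ[volume.restrict U] partialDeriv i φ}

/-- The `L²` product `(u, v) = ∫_U u v̄`. -/
def l2Form {d : ℕ} {U : Set (EuclideanSpace ℝ (Fin d))} (u v : L2 U) : ℂ :=
  ∫ x in U, u x * conj (v x)

/-- The energy product `⟨u, v⟩ = ∫_U ∇u · ∇v̄`. -/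
def energyForm {d : ℕ} {U : Set (EuclideanSpace ℝ (Fin d))} (p q : Jet U) : ℂ :=
  ∑ i, l2Form (p.2 i) (q.2 i)

/-- `L²₀(Y)`: the functions in `L²(Y)` with `∫_Y u = 0`. -/
def L20 (d : ℕ) : Submodule ℂ (L2 (unitCell d)) where
  carrier := {u | ∫ x in unitCell d, u x = 0}
  zero_mem' := by
    change ∫ x in unitCell d, (0 : L2 (unitCell d)) x = 0
    rw [integral_congr_ae (Lp.coeFn_zero ℂ 2 (volume.restrict (unitCell d)))]
    simp
  add_mem' := by
    intro u v hu hv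
    have := isFiniteMeasure_unitCell d
    change ∫ x in unitCell d, (u + v) x = 0
    rw [integral_congr_ae (Lp.coeFn_add u v)]
    have hu' := (Lp.memLp u).integrable (by norm_num)
    have hv' := (Lp.memLp v).integrable (by norm_num)
    simp only [Pi.add_apply]
    rw [integral_add hu' hv']
    simp only [Set.mem_ofPred_eq] at hu hv
    rw [hu, hv, add_zero]
  smul_mem' := by
    intro c u hu
    change ∫ x in unitCell d, (c • u) x = 0
    rw [integral_congr_ae (Lp.coeFn_smul c u)]
    simp only [Pi.smul_apply]
    simp only [Set.mem_ofPred_eq] at hu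
    rw [integral_smul, hu, smul_zero]

/-- The space `𝓗 = {u ∈ H¹(Y) : ∫_Y u = 0}`. -/
def meanZeroH1 (d : ℕ) : Set (Jet (unitCell d)) :=
  {p | p ∈ H1 (unitCell d) ∧ p.1 ∈ L20 d}

/-- The space `W₂` of the functions `ũ - (∫_D ũ) 1_Y`, where `ũ` is the extension by zero to `Y`
of a function of `H¹₀(D)`; the gradient of such a function is the extension by zero of the
gradient. -/
def W2 {d : ℕ} (D : Set (EuclideanSpace ℝ (Fin d))) : Set (Jet (unitCell d)) :=
  {p | ∃ q ∈ H10 D,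
    (p.1 =ᵐ[volume.restrict (unitCell d)] fun x => D.indicator q.1 x - ∫ y in D, q.1 y) ∧
    ∀ i, p.2 i =ᵐ[volume.restrict (unitCell d)] D.indicator (q.2 i)}

/-- `w = (-Δ_N)⁻¹ f`: the element `w` of `𝓗` with `⟨w, v⟩ = (f, v)` for all `v ∈ 𝓗`. -/
def IsNeumannSolution {d : ℕ} (f : L20 d) (w : Jet (unitCell d)) : Prop :=
  w ∈ meanZeroH1 d ∧ ∀ v ∈ meanZeroH1 d, energyForm w v = l2Form (f : L2 (unitCell d)) v.1

/-- `p = P₂ w`: the orthogonal projection of `w ∈ 𝓗` onto `W₂`, with respect to the energy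
product. -/
def IsProjectionW2 {d : ℕ} (D : Set (EuclideanSpace ℝ (Fin d)))
    (w p : Jet (unitCell d)) : Prop :=
  p ∈ W2 D ∧ ∀ v ∈ W2 D, energyForm (w - p) v = 0

/-- `A = P₂ (-Δ_N)⁻¹` as a bounded operator on `L²₀(Y)`. -/
def IsLimitOperator {d : ℕ} (D : Set (EuclideanSpace ℝ (Fin d)))
    (A : L20 d →L[ℂ] L20 d) : Prop :=
  ∀ f, ∃ w p, IsNeumannSolution f w ∧ IsProjectionW2 D w p ∧ p.1 = A f

/-- `ψ` is a Dirichlet eigenfunction of `-Δ` on `D` with eigenvalue `δ`. -/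
def IsDirichletEigenfunction {d : ℕ} (D : Set (EuclideanSpace ℝ (Fin d)))
    (δ : ℝ) (ψ : L2 D) : Prop :=
  ψ ≠ 0 ∧ ∃ p ∈ H10 D, p.1 = ψ ∧ ∀ v ∈ H10 D, energyForm p v = δ * l2Form ψ v.1

/-- The mean `∫_D ψ`. -/
def meanOn {d : ℕ} {D : Set (EuclideanSpace ℝ (Fin d))} (ψ : L2 D) : ℂ :=
  ∫ x in D, ψ x

/-- `ψ` is a complete orthonormal system of Dirichlet eigenfunctions with eigenvalues `δ`. -/
def IsDirichletEigenbasis {d : ℕ} (D : Set (EuclideanSpace ℝ (Fin d)))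
    (ψ : HilbertBasis ℕ ℂ (L2 D)) (δ : ℕ → ℝ) : Prop :=
  ∀ i, IsDirichletEigenfunction D (δ i) (ψ i)

/-- `S(ν) = ν ∑ a_i² / (ν - δ_i) - 1`, the sum over the `i` with `∫_D ψ_i ≠ 0`, where
`a_i = |∫_D ψ_i|`. A divergent series counts as `0`, so it never produces a root of `S`. -/
def spectralFunction {d : ℕ} {D : Set (EuclideanSpace ℝ (Fin d))}
    (ψ : HilbertBasis ℕ ℂ (L2 D)) (δ : ℕ → ℝ) (ν : ℝ) : ℝ :=
  ν * ∑' i : {i : ℕ // meanOn (ψ i) ≠ 0}, ‖meanOn (ψ i)‖ ^ 2 / (ν - δ i) - 1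

/-- The Dirichlet eigenvalues of `D` that have an eigenfunction of mean zero. -/
def meanZeroEigenvalues {d : ℕ} (D : Set (EuclideanSpace ℝ (Fin d))) : Set ℝ :=
  {δ | ∃ ψ : L2 D, IsDirichletEigenfunction D δ ψ ∧ meanOn ψ = 0}

/-- The positive roots of `S`; the poles `δ_i`, `∫_D ψ_i ≠ 0`, do not belong to the domain
of `S`. -/
def spectralRoots {d : ℕ} {D : Set (EuclideanSpace ℝ (Fin d))}
    (ψ : HilbertBasis ℕ ℂ (L2 D)) (δ : ℕ → ℝ) : Set ℝ :=
  {ν | 0 < ν ∧ (∀ i, meanOn (ψ i) ≠ 0 → ν ≠ δ i) ∧ spectralFunction ψ δ ν = 0}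

/-- The set of reciprocals of a set of real numbers, as a subset of `ℂ`. -/
def reciprocals (s : Set ℝ) : Set ℂ :=
  (fun t : ℝ => ((t⁻¹ : ℝ) : ℂ)) '' s

end

/-!
The operator of the theorem factors through the inverse Dirichlet Laplacian
`G = (-Δ_D)⁻¹` of `D`. Let `E : L²(D) → L²₀(Y)`, `E u = ũ - (∫_D ũ) 1_Y`, and let `R` be the
restriction of functions on `Y` to `D`, which is the adjoint of `E` on `L²₀(Y)`. For `f ∈ L²₀(Y)`
and `w = (-Δ_N)⁻¹ f`, testing with the elements of `W₂` gives `⟨w, E v⟩ = (f, E v) = (R f, v)_D`,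
so that `P₂ w = E u` with `u = G R f`. Hence `A = E G R` (`isLimitOperator_iff`).

`A` is compact and nonnegative, so its spectrum consists of `0` and of positive eigenvalues. As
`R E u = u - (o, u) o` with `o = 1_D`, the nonzero eigenvalues of `E G R` are those of the rank one
perturbation `g ↦ G g - (o, G g) o` of `G` (`mem_spectrum_limit_iff`). Suppose that `g` is an
eigenvector with eigenvalue `1/ν`, and let `u = G g`. If `(o, u) = 0`, then `u` is a Dirichlet
eigenfunction of mean zero. Otherwise the expansion of `u` in the eigenbasis gives
`(ν - δᵢ) (u, ψᵢ) = ν (o, u) (1, ψᵢ)`, and the pairing of `u` with `o` turns this into the secular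
equation `S(ν) = 0`. Conversely, a root `ν` of `S` defines the coefficients of an eigenvector; they
are square summable since the `δᵢ` do not accumulate at `ν` (`exists_rankOne_eigenvector_iff`).

The analytic input is a single inequality on the cell, `norm_sub_cosTruncation_le`. The products
of the functions `cos (π kⱼ xⱼ)` form an orthogonal basis of `L²(Y)`, by the Stone-Weierstrass
theorem. An `H¹` function can be integrated by parts against the product that has
`sin (π kᵢ xᵢ)` as `i`-th factor (`integral_mul_deriv_tensor`), whence `π kᵢ` times the cosine
coefficient of `u` is, up to sign, a sine coefficient of `∂ᵢ u`. Bessel's inequality then bounds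
the remainders of the cosine series of `u` by `‖∇u‖`. The first remainder gives the
Poincaré-Wirtinger inequality, and with it the existence of `(-Δ_N)⁻¹`; the later ones show that
`H¹₀(D)` embeds compactly into `L²(D)`, so that `G` is compact.
-/

/-! ### Variational problems on a space of pairs -/

section Variational

variable {X : Type*} [NormedAddCommGroup X] [InnerProductSpace ℂ X] [CompleteSpace X]
  {ι : Type*} [Fintype ι]

/-- A closed space `V` of pairs `(u, g)` on which `‖u‖ ≤ C ‖g‖` is the graph of a bounded operator
`g ↦ u` on a closed subspace. -/
theorem exists_graph_of_norm_fst_le (V : Submodule ℂ (X × (ι → X)))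
    (hV : IsClosed (V : Set (X × (ι → X)))) (C : ℝ)
    (hC : ∀ p ∈ V, ‖p.1‖ ≤ C * ‖WithLp.toLp 2 p.2‖) :
    ∃ (K : Submodule ℂ (PiLp 2 fun _ : ι => X)) (T : K →L[ℂ] X),
      IsClosed (K : Set (PiLp 2 fun _ : ι => X)) ∧
      (∀ κ : K, (T κ, WithLp.ofLp κ.1) ∈ V) ∧
      ∀ p ∈ V, ∃ h : WithLp.toLp 2 p.2 ∈ K, T ⟨_, h⟩ = p.1 := by
  let K : Submodule ℂ (PiLp 2 fun _ : ι => X) :=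
    { carrier := {κ | ∃ x, (x, WithLp.ofLp κ) ∈ V}
      zero_mem' := ⟨0, V.zero_mem⟩
      add_mem' := by
        rintro a b ⟨x, hx⟩ ⟨y, hy⟩
        exact ⟨x + y, V.add_mem hx hy⟩
      smul_mem' := by
        rintro c a ⟨x, hx⟩
        exact ⟨c • x, V.smul_mem c hx⟩ }
  have huniq : ∀ (x y : X) (g : ι → X), (x, g) ∈ V → (y, g) ∈ V → x = y := by
    intro x y g hx hy
    have h := hC _ (V.sub_mem hx hy)
    have h0 : WithLp.toLp 2 ((x, g) - (y, g)).2 = (0 : PiLp 2 fun _ : ι => X) := by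
      simp
    rw [h0, norm_zero, mul_zero] at h
    simpa [sub_eq_zero] using h
  choose x hx using fun κ : K => κ.2
  let T : K →L[ℂ] X := LinearMap.mkContinuous
    { toFun := x
      map_add' := fun a b => huniq _ _ _ (hx (a + b)) (V.add_mem (hx a) (hx b))
      map_smul' := fun c a => huniq _ _ _ (hx (c • a)) (V.smul_mem c (hx a)) } C
    (fun κ => hC _ (hx κ))
  refine ⟨K, T, ?_, hx, fun p hp => ⟨⟨p.1, hp⟩, huniq _ _ _ (hx ⟨_, ⟨p.1, hp⟩⟩) hp⟩⟩
  refine IsSeqClosed.isClosed fun κ k hκ hk => ?_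
  have hc : CauchySeq fun n => (⟨κ n, hκ n⟩ : K) := by
    have := hk.cauchySeq
    rw [Metric.cauchySeq_iff] at this ⊢
    exact this
  obtain ⟨y, hy⟩ := cauchySeq_tendsto_of_complete (T.uniformContinuous.comp_cauchySeq hc)
  refine ⟨y, hV.mem_of_tendsto (hy.prodMk_nhds
    (((PiLp.continuous_ofLp 2 _).tendsto k).comp hk)) (Filter.Eventually.of_forall fun n => ?_)⟩
  exact hx ⟨κ n, hκ n⟩

/-- The solution operator of the variational problem `⟨p, v⟩ = (f, v)`, `v ∈ V`, on a space `V` of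
pairs on which a Poincaré inequality holds. It is `T T*`, where `T` is the operator whose graph
is `V`. Compactness follows when `T` is a norm limit of compact operators `P T`. -/
theorem exists_solution_operator (V : Submodule ℂ (X × (ι → X)))
    (hV : IsClosed (V : Set (X × (ι → X)))) (C : ℝ)
    (hC : ∀ p ∈ V, ‖p.1‖ ≤ C * ‖WithLp.toLp 2 p.2‖) :
    ∃ G : X →L[ℂ] X, G.IsSymmetric ∧
      (∀ f, ∃ p ∈ V, p.1 = G f ∧ ∀ v ∈ V, ∑ i, inner ℂ (v.2 i) (p.2 i) = inner ℂ v.1 f) ∧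
      ((∀ ε > 0, ∃ P : X →L[ℂ] X, IsCompactOperator P ∧
        ∀ p ∈ V, ‖p.1 - P p.1‖ ≤ ε * ‖WithLp.toLp 2 p.2‖) → IsCompactOperator G) := by
  obtain ⟨K, T, hK, hT, hV'⟩ := exists_graph_of_norm_fst_le V hV C hC
  have : CompleteSpace K := hK.completeSpace_coe
  refine ⟨T ∘L T.adjoint, ?_, ?_, ?_⟩
  · intro u v
    change inner ℂ (T (T.adjoint u)) v = inner ℂ u (T (T.adjoint v))
    rw [← ContinuousLinearMap.adjoint_inner_right, ContinuousLinearMap.adjoint_inner_left]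
  · intro f
    refine ⟨_, hT (T.adjoint f), rfl, fun v hv => ?_⟩
    obtain ⟨h, hTv⟩ := hV' v hv
    rw [← hTv, ← ContinuousLinearMap.adjoint_inner_right, Submodule.coe_inner, PiLp.inner_apply]
  · intro hP
    refine IsCompactOperator.comp_clm ?_ T.adjoint
    have hmem : T ∈ closure {S : K →L[ℂ] X | IsCompactOperator S} := by
      refine (Metric.mem_closure_iff (α := K →L[ℂ] X)).2 ?_
      intro ε hε
      obtain ⟨P, hPc, hPb⟩ := hP (ε / 2) (by positivity)
      refine ⟨P ∘L T, hPc.comp_clm T, ?_⟩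
      refine (dist_eq_norm T (P ∘L T)).trans_lt <| lt_of_le_of_lt
        (ContinuousLinearMap.opNorm_le_bound _ (by positivity) fun κ => ?_)
        (half_lt_self hε)
      exact hPb _ (hT κ)
    rwa [(isClosed_setOfPred_isCompactOperator).closure_eq] at hmem

end Variational

/-! ### Weak gradients and extension by zero -/

section Sobolev

variable {d : ℕ}

theorem l2Form_eq_inner {U : Set (EuclideanSpace ℝ (Fin d))} (u v : L2 U) :
    l2Form u v = inner ℂ v u := by
  rw [l2Form, L2.inner_def]
  simp [RCLike.inner_apply]

theorem energyForm_eq_sum_inner {U : Set (EuclideanSpace ℝ (Fin d))} (p q : Jet U) :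
    energyForm p q = ∑ i, inner ℂ (q.2 i) (p.2 i) := by
  simp only [energyForm, l2Form_eq_inner]

theorem exists_clm_integral_mul {α : Type*} [MeasurableSpace α] {μ : Measure α} {f : α → ℂ}
    (hf : MemLp f 2 μ) : ∃ L : Lp ℂ 2 μ →L[ℂ] ℂ, ∀ u, L u = ∫ x, u x * f x ∂μ := by
  refine ⟨innerSL ℂ (hf.star.toLp _), fun u => ?_⟩
  rw [innerSL_apply_apply, L2.inner_def]
  refine integral_congr_ae ?_
  filter_upwards [hf.star.coeFn_toLp] with x hx
  simp [hx, RCLike.inner_apply]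

theorem memLp_of_continuous_of_hasCompactSupport {f : EuclideanSpace ℝ (Fin d) → ℂ}
    (hf : Continuous f) (hc : HasCompactSupport f) (U : Set (EuclideanSpace ℝ (Fin d))) :
    MemLp f 2 (volume.restrict U) :=
  (hf.memLp_of_hasCompactSupport hc).restrict U

theorem continuous_partialDeriv {f : EuclideanSpace ℝ (Fin d) → ℂ} (hf : ContDiff ℝ ∞ f)
    (i : Fin d) : Continuous (partialDeriv i f) :=
  (hf.continuous_fderiv (by simp)).clm_apply continuous_const

theorem support_partialDeriv_subset (f : EuclideanSpace ℝ (Fin d) → ℂ) (i : Fin d) :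
    Function.support (partialDeriv i f) ⊆ tsupport f := by
  intro x hx
  refine support_fderiv_subset ℝ (f := f) fun h => hx ?_
  simp [partialDeriv, h]

theorem hasCompactSupport_partialDeriv {f : EuclideanSpace ℝ (Fin d) → ℂ}
    (hf : HasCompactSupport f) (i : Fin d) : HasCompactSupport (partialDeriv i f) :=
  hf.mono' (support_partialDeriv_subset f i)

theorem IsTestFunction.memLp {U : Set (EuclideanSpace ℝ (Fin d))}
    {φ : EuclideanSpace ℝ (Fin d) → ℂ} (h : IsTestFunction U φ)
    (W : Set (EuclideanSpace ℝ (Fin d))) : MemLp φ 2 (volume.restrict W) :=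
  memLp_of_continuous_of_hasCompactSupport h.1.continuous h.2.1 W

theorem IsTestFunction.memLp_partialDeriv {U : Set (EuclideanSpace ℝ (Fin d))}
    {φ : EuclideanSpace ℝ (Fin d) → ℂ} (h : IsTestFunction U φ) (i : Fin d)
    (W : Set (EuclideanSpace ℝ (Fin d))) : MemLp (partialDeriv i φ) 2 (volume.restrict W) :=
  memLp_of_continuous_of_hasCompactSupport (continuous_partialDeriv h.1 i)
    (hasCompactSupport_partialDeriv h.2.1 i) W

theorem partialDeriv_add {f g : EuclideanSpace ℝ (Fin d) → ℂ} (hf : ContDiff ℝ ∞ f)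
    (hg : ContDiff ℝ ∞ g) (i : Fin d) (x : EuclideanSpace ℝ (Fin d)) :
    partialDeriv i (f + g) x = partialDeriv i f x + partialDeriv i g x := by
  rw [partialDeriv, fderiv_add (hf.differentiable (by simp) x) (hg.differentiable (by simp) x)]
  rfl

theorem partialDeriv_const_smul {f : EuclideanSpace ℝ (Fin d) → ℂ} (hf : ContDiff ℝ ∞ f)
    (c : ℂ) (i : Fin d) (x : EuclideanSpace ℝ (Fin d)) :
    partialDeriv i (c • f) x = c * partialDeriv i f x := by
  rw [partialDeriv, fderiv_const_smul (hf.differentiable (by simp) x)]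
  rfl

theorem exists_submodule_H1 (U : Set (EuclideanSpace ℝ (Fin d))) :
    ∃ V : Submodule ℂ (Jet U), (V : Set (Jet U)) = H1 U ∧ IsClosed (V : Set (Jet U)) := by
  have key : ∀ i : Fin d, ∀ φ, IsTestFunction U φ → ∃ L : Jet U →L[ℂ] ℂ, ∀ p, L p =
      (∫ x in U, p.1 x * partialDeriv i φ x) + ∫ x in U, p.2 i x * φ x := by
    intro i φ hφ
    obtain ⟨L₁, h₁⟩ := exists_clm_integral_mul (hφ.memLp_partialDeriv i U)
    obtain ⟨L₂, h₂⟩ := exists_clm_integral_mul (hφ.memLp U)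
    refine ⟨L₁ ∘L ContinuousLinearMap.fst ℂ _ _ +
      L₂ ∘L ContinuousLinearMap.proj i ∘L ContinuousLinearMap.snd ℂ _ _, fun p => ?_⟩
    simp [h₁, h₂]
  choose L hL using key
  refine ⟨⨅ i, ⨅ φ, ⨅ h : IsTestFunction U φ, (L i φ h).ker, ?_, ?_⟩
  · ext p
    simp only [Submodule.coe_iInf, Set.mem_iInter, SetLike.mem_coe, LinearMap.mem_ker, H1,
      Set.mem_ofPred_eq, ContinuousLinearMap.coe_coe, hL, add_eq_zero_iff_eq_neg]
  · simp only [Submodule.coe_iInf]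
    exact isClosed_iInter fun i => isClosed_iInter fun φ => isClosed_iInter fun h =>
      (L i φ h).isClosed_ker

theorem exists_submodule_H10 (U : Set (EuclideanSpace ℝ (Fin d))) :
    ∃ V : Submodule ℂ (Jet U), (V : Set (Jet U)) = H10 U ∧ IsClosed (V : Set (Jet U)) := by
  let S : Submodule ℂ (Jet U) :=
    { carrier := {p | ∃ φ, IsTestFunction U φ ∧ p.1 =ᵐ[volume.restrict U] φ ∧
        ∀ i, p.2 i =ᵐ[volume.restrict U] partialDeriv i φ}
      zero_mem' := by
        refine ⟨0, ⟨contDiff_const, HasCompactSupport.zero, by simp [tsupport]⟩,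
          Lp.coeFn_zero _ _ _, fun i => (Lp.coeFn_zero _ _ _).trans ?_⟩
        refine Filter.Eventually.of_forall fun x => ?_
        simp [partialDeriv]
      add_mem' := by
        rintro p q ⟨φ, hφ, h₁, h₂⟩ ⟨χ, hχ, h₃, h₄⟩
        refine ⟨φ + χ, ⟨hφ.1.add hχ.1, hφ.2.1.add hχ.2.1, (tsupport_add φ χ).trans
          (Set.union_subset hφ.2.2 hχ.2.2)⟩, (Lp.coeFn_add _ _).trans (h₁.add h₃), fun i =>
          (Lp.coeFn_add _ _).trans ?_⟩
        filter_upwards [h₂ i, h₄ i] with x hx hy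
        rw [partialDeriv_add hφ.1 hχ.1, Pi.add_apply, hx, hy]
      smul_mem' := by
        rintro c p ⟨φ, hφ, h₁, h₂⟩
        refine ⟨c • φ, ⟨contDiff_const.smul hφ.1, hφ.2.1.smul_left (f := fun _ => c),
          (tsupport_smul_subset_right (fun _ => c) φ).trans hφ.2.2⟩,
          (Lp.coeFn_smul _ _).trans (h₁.const_smul c), fun i =>
          (Lp.coeFn_smul _ _).trans ?_⟩
        filter_upwards [h₂ i] with x hx
        rw [partialDeriv_const_smul hφ.1, Pi.smul_apply, hx, smul_eq_mul] }
  exact ⟨S.topologicalClosure, rfl, S.isClosed_topologicalClosure⟩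

theorem integral_mul_partialDeriv {f φ : EuclideanSpace ℝ (Fin d) → ℂ} (hf : ContDiff ℝ ∞ f)
    (hφ : ContDiff ℝ ∞ φ) (hc : HasCompactSupport φ) (i : Fin d) :
    ∫ x, f x * partialDeriv i φ x = - ∫ x, partialDeriv i f x * φ x := by
  refine integral_mul_fderiv_eq_neg_fderiv_mul_of_integrable ?_ ?_ ?_
    (fun x _ => hf.differentiable (by simp) x) (fun x _ => hφ.differentiable (by simp) x)
  · exact ((continuous_partialDeriv hf i).mul hφ.continuous).integrable_of_hasCompactSupport
      hc.mul_left
  · exact (hf.continuous.mul (continuous_partialDeriv hφ i)).integrable_of_hasCompactSupport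
      (hasCompactSupport_partialDeriv hc i).mul_left
  · exact (hf.continuous.mul hφ.continuous).integrable_of_hasCompactSupport hc.mul_left

theorem setIntegral_mul_eq_integral {U : Set (EuclideanSpace ℝ (Fin d))}
    {f φ : EuclideanSpace ℝ (Fin d) → ℂ} (hφ : Function.support φ ⊆ U) :
    ∫ x in U, f x * φ x = ∫ x, f x * φ x := by
  refine setIntegral_eq_integral_of_forall_compl_eq_zero fun x hx => ?_
  rw [Function.notMem_support.mp fun h => hx (hφ h), mul_zero]

/-- The classical gradient of a smooth function is its weak gradient. -/
theorem mem_H1_of_contDiff {U : Set (EuclideanSpace ℝ (Fin d))}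
    {f : EuclideanSpace ℝ (Fin d) → ℂ} (hf : ContDiff ℝ ∞ f) {p : Jet U}
    (h₁ : p.1 =ᵐ[volume.restrict U] f)
    (h₂ : ∀ i, p.2 i =ᵐ[volume.restrict U] partialDeriv i f) : p ∈ H1 U := by
  intro i φ hφ
  have e₁ : ∫ x in U, p.1 x * partialDeriv i φ x = ∫ x in U, f x * partialDeriv i φ x :=
    integral_congr_ae (by filter_upwards [h₁] with x hx; rw [hx])
  have e₂ : ∫ x in U, p.2 i x * φ x = ∫ x in U, partialDeriv i f x * φ x :=
    integral_congr_ae (by filter_upwards [h₂ i] with x hx; rw [hx])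
  rw [e₁, e₂, setIntegral_mul_eq_integral ((support_partialDeriv_subset φ i).trans hφ.2.2),
    setIntegral_mul_eq_integral ((subset_tsupport φ).trans hφ.2.2),
    integral_mul_partialDeriv hf hφ.1 hφ.2.1]

theorem memLp_indicator_of_subset {D U : Set (EuclideanSpace ℝ (Fin d))} (hD : MeasurableSet D)
    (hDU : D ⊆ U) {f : EuclideanSpace ℝ (Fin d) → ℂ} (hf : MemLp f 2 (volume.restrict D)) :
    MemLp (D.indicator f) 2 (volume.restrict U) := by
  rw [memLp_indicator_iff_restrict hD, Measure.restrict_restrict hD,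
    Set.inter_eq_self_of_subset_left hDU]
  exact hf

theorem ae_indicator_of_ae {D U : Set (EuclideanSpace ℝ (Fin d))} (hD : MeasurableSet D)
    {f g : EuclideanSpace ℝ (Fin d) → ℂ} (h : f =ᵐ[volume.restrict D] g) :
    D.indicator f =ᵐ[volume.restrict U] D.indicator g := by
  refine ae_restrict_of_ae ?_
  rw [Filter.EventuallyEq, ae_restrict_iff' hD] at h
  filter_upwards [h] with x hx
  by_cases hxD : x ∈ D
  · simp [hxD, hx hxD]
  · simp [hxD]

/-- Extension by zero, as an isometry `L²(D) → L²(U)`. -/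
noncomputable def extendZero {D U : Set (EuclideanSpace ℝ (Fin d))} (hD : MeasurableSet D)
    (hDU : D ⊆ U) : L2 D →ₗᵢ[ℂ] L2 U where
  toFun u := (memLp_indicator_of_subset hD hDU (Lp.memLp u)).toLp _
  map_add' u v := by
    rw [← MemLp.toLp_add, MemLp.toLp_eq_toLp_iff, ← Set.indicator_add']
    exact ae_indicator_of_ae hD (Lp.coeFn_add u v)
  map_smul' c u := by
    rw [RingHom.id_apply, ← MemLp.toLp_const_smul, MemLp.toLp_eq_toLp_iff]
    refine (ae_indicator_of_ae hD (Lp.coeFn_smul c u)).trans ?_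
    refine Filter.Eventually.of_forall fun x => ?_
    exact Set.indicator_const_smul_apply D c u x
  norm_map' u := by
    change ‖(memLp_indicator_of_subset hD hDU (Lp.memLp u)).toLp _‖ = ‖u‖
    rw [Lp.norm_toLp, eLpNorm_indicator_eq_eLpNorm_restrict hD, Measure.restrict_restrict hD,
      Set.inter_eq_self_of_subset_left hDU, Lp.norm_def]

variable {D U : Set (EuclideanSpace ℝ (Fin d))} (hD : MeasurableSet D) (hDU : D ⊆ U)

theorem coeFn_extendZero (u : L2 D) :
    extendZero hD hDU u =ᵐ[volume.restrict U] D.indicator u :=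
  (memLp_indicator_of_subset hD hDU (Lp.memLp u)).coeFn_toLp

theorem integral_indicator_of_subset (hD : MeasurableSet D) (hDU : D ⊆ U)
    (f : EuclideanSpace ℝ (Fin d) → ℂ) :
    ∫ x in U, D.indicator f x = ∫ x in D, f x := by
  rw [integral_indicator hD, Measure.restrict_restrict hD,
    Set.inter_eq_self_of_subset_left hDU]

theorem isClosed_H1 (U : Set (EuclideanSpace ℝ (Fin d))) : IsClosed (H1 U) := by
  obtain ⟨V, hV, hVc⟩ := exists_submodule_H1 U
  exact hV ▸ hVc

/-- The pairs `(φ, ∇φ)` with `φ ∈ C_c^∞(U)`. -/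
def testJets (U : Set (EuclideanSpace ℝ (Fin d))) : Set (Jet U) :=
  {p | ∃ φ, IsTestFunction U φ ∧ p.1 =ᵐ[volume.restrict U] φ ∧
    ∀ i, p.2 i =ᵐ[volume.restrict U] partialDeriv i φ}

theorem mapsTo_H1_of_mapsTo_testJets {F : Jet D → Jet U} (hF : Continuous F)
    (h : ∀ p ∈ testJets D, F p ∈ H1 U) {q : Jet D} (hq : q ∈ H10 D) : F q ∈ H1 U :=
  closure_minimal (t := F ⁻¹' H1 U) h ((isClosed_H1 U).preimage hF) hq

/-- Apply an operator `L²(D) → L²(U)` to a function and to each component of its gradient. -/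
noncomputable def mapJet (J : L2 D →L[ℂ] L2 U) (q : Jet D) : Jet U :=
  (J q.1, fun i => J (q.2 i))

theorem continuous_mapJet (J : L2 D →L[ℂ] L2 U) : Continuous (mapJet J) := by
  unfold mapJet
  fun_prop

theorem mapJet_mem_H1_of_mem_testJets (hD : MeasurableSet D) (J : L2 D →L[ℂ] L2 U)
    (hJ : ∀ u, J u =ᵐ[volume.restrict U] D.indicator u) {q : Jet D} (hq : q ∈ testJets D) :
    mapJet J q ∈ H1 U := by
  obtain ⟨φ, hφ, h₁, h₂⟩ := hq
  refine mem_H1_of_contDiff hφ.1 ?_ fun i => ?_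
  · refine (hJ _).trans ((ae_indicator_of_ae hD h₁).trans ?_)
    rw [Set.indicator_eq_self.2 ((subset_tsupport φ).trans hφ.2.2)]
  · refine (hJ _).trans ((ae_indicator_of_ae hD (h₂ i)).trans ?_)
    rw [Set.indicator_eq_self.2 ((support_partialDeriv_subset φ i).trans hφ.2.2)]

/-- The extension by zero of a function of `H¹₀(D)` has the extended gradient as weak gradient. -/
theorem mapJet_mem_H1 (hD : MeasurableSet D) (J : L2 D →L[ℂ] L2 U)
    (hJ : ∀ u, J u =ᵐ[volume.restrict U] D.indicator u) {q : Jet D} (hq : q ∈ H10 D) :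
    mapJet J q ∈ H1 U :=
  mapsTo_H1_of_mapsTo_testJets (continuous_mapJet J)
    (fun _ hp => mapJet_mem_H1_of_mem_testJets hD J hJ hp) hq

end Sobolev

/-! ### The Poincaré inequality on `H¹₀` -/

section DirichletPoincare

theorem norm_sq_eq_integral_norm_sq {α : Type*} [MeasurableSpace α] {μ : Measure α}
    (u : Lp ℂ 2 μ) : ‖u‖ ^ 2 = ∫ x, ‖u x‖ ^ 2 ∂μ := by
  have h : ((‖u‖ ^ 2 : ℝ) : ℂ) = ((∫ x, ‖u x‖ ^ 2 ∂μ : ℝ) : ℂ) := by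
    rw [← integral_complex_ofReal]
    push_cast
    have := inner_self_eq_norm_sq_to_K (𝕜 := ℂ) u
    rw [L2.inner_def] at this
    simpa using this.symm
  exact_mod_cast h

variable {d : ℕ}

/-- Integration by parts, with the `i`-th coordinate as second factor. -/
theorem integral_coord_mul_fderiv {F : EuclideanSpace ℝ (Fin d) → ℝ} (hF : ContDiff ℝ ∞ F)
    (hc : HasCompactSupport F) (i : Fin d) :
    Integrable (fun x => x i * fderiv ℝ F x (EuclideanSpace.single i 1)) ∧
    ∫ x, x i * fderiv ℝ F x (EuclideanSpace.single i 1) = - ∫ x, F x := by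
  have hFdc : Continuous fun x => fderiv ℝ F x (EuclideanSpace.single i 1) :=
    (hF.continuous_fderiv (by simp)).clm_apply continuous_const
  have hFdsupp : HasCompactSupport
      fun x => fderiv ℝ F x (EuclideanSpace.single i (1 : ℝ)) := by
    refine hc.mono' fun x hx => support_fderiv_subset ℝ fun h => hx ?_
    simp [h]
  have hd (x : EuclideanSpace ℝ (Fin d)) :
      HasFDerivAt (fun x : EuclideanSpace ℝ (Fin d) => x i)
        (EuclideanSpace.proj i : EuclideanSpace ℝ (Fin d) →L[ℝ] ℝ) x :=
    (EuclideanSpace.proj i : EuclideanSpace ℝ (Fin d) →L[ℝ] ℝ).hasFDerivAt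
  have hℓ : ∀ x, fderiv ℝ (fun x : EuclideanSpace ℝ (Fin d) => x i) x
      (EuclideanSpace.single i 1) = 1 := by
    intro x
    rw [(hd x).fderiv]
    simp
  have hi : Continuous fun x : EuclideanSpace ℝ (Fin d) => x i := by fun_prop
  have hint := (hi.mul hFdc).integrable_of_hasCompactSupport (μ := volume) hFdsupp.mul_left
  have := integral_mul_fderiv_eq_neg_fderiv_mul_of_integrable (μ := volume)
    (f := fun x : EuclideanSpace ℝ (Fin d) => x i) (g := F) (v := EuclideanSpace.single i 1)
    (by simpa only [hℓ, one_mul] using hF.continuous.integrable_of_hasCompactSupport hc) hint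
    ((hi.mul hF.continuous).integrable_of_hasCompactSupport hc.mul_left)
    (fun x _ => (hd x).differentiableAt) (fun x _ => hF.differentiable (by simp) x)
  simp only [hℓ, one_mul] at this
  exact ⟨hint, this⟩

theorem fderiv_norm_sq_apply_single {φ : EuclideanSpace ℝ (Fin d) → ℂ}
    (hφ : Differentiable ℝ φ) (i : Fin d) (x : EuclideanSpace ℝ (Fin d)) :
    fderiv ℝ (fun x => ‖φ x‖ ^ 2) x (EuclideanSpace.single i 1) =
      2 * inner ℝ (φ x) (partialDeriv i φ x) := by
  rw [(hφ x).hasFDerivAt.norm_sq.fderiv]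
  simp [partialDeriv]
  ring

theorem neg_mul_two_inner_le {t : ℝ} (ht : |t| ≤ 1) (z w : ℂ) :
    -(t * (2 * inner ℝ z w)) ≤ 1 / 2 * ‖z‖ ^ 2 + 2 * ‖w‖ ^ 2 := by
  have h := abs_real_inner_le_norm z w
  calc -(t * (2 * inner ℝ z w)) ≤ |t * (2 * inner ℝ z w)| := neg_le_abs _
    _ = |t| * (2 * |inner ℝ z w|) := by rw [abs_mul, abs_mul, abs_two]
    _ ≤ 1 * (2 * (‖z‖ * ‖w‖)) := by gcongr
    _ ≤ _ := by nlinarith [sq_nonneg (‖z‖ - 2 * ‖w‖)]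

theorem hasCompactSupport_norm_sq {f : EuclideanSpace ℝ (Fin d) → ℂ} (hf : HasCompactSupport f) :
    HasCompactSupport fun x => ‖f x‖ ^ 2 :=
  hf.mono' fun x hx => subset_tsupport f fun h => hx (by simp [h])

theorem integrable_norm_sq_of_hasCompactSupport {f : EuclideanSpace ℝ (Fin d) → ℂ}
    (hf : Continuous f) (hc : HasCompactSupport f) : Integrable fun x => ‖f x‖ ^ 2 :=
  (hf.norm.pow 2).integrable_of_hasCompactSupport (hasCompactSupport_norm_sq hc)

/-- `∫ |φ|² = -∫ xᵢ ∂ᵢ|φ|²`, and `|xᵢ| ≤ 1` on the support of `φ`. -/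
theorem integral_norm_sq_le_of_isTestFunction {φ : EuclideanSpace ℝ (Fin d) → ℂ}
    (hφ : IsTestFunction (unitCell d) φ) (i : Fin d) :
    ∫ x, ‖φ x‖ ^ 2 ≤ 4 * ∫ x, ‖partialDeriv i φ x‖ ^ 2 := by
  have hF : ContDiff ℝ ∞ fun x => ‖φ x‖ ^ 2 := hφ.1.norm_sq ℝ
  have hFi := integrable_norm_sq_of_hasCompactSupport hφ.1.continuous hφ.2.1
  have hGi := integrable_norm_sq_of_hasCompactSupport (continuous_partialDeriv hφ.1 i)
    (hasCompactSupport_partialDeriv hφ.2.1 i)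
  obtain ⟨hint, hibp⟩ := integral_coord_mul_fderiv hF (hasCompactSupport_norm_sq hφ.2.1) i
  have hle : ∫ x, -(x i * fderiv ℝ (fun x => ‖φ x‖ ^ 2) x (EuclideanSpace.single i 1)) ≤
      ∫ x, (1 / 2 * ‖φ x‖ ^ 2 + 2 * ‖partialDeriv i φ x‖ ^ 2) := by
    refine integral_mono hint.neg ((hFi.const_mul _).add (hGi.const_mul _)) fun x => ?_
    dsimp only
    rw [fderiv_norm_sq_apply_single (hφ.1.differentiable (by simp))]
    by_cases hx : x ∈ unitCell d
    · exact neg_mul_two_inner_le (abs_le.2 ⟨by linarith [(hx i).1], (hx i).2.le⟩) _ _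
    · rw [image_eq_zero_of_notMem_tsupport fun h => hx (hφ.2.2 h), inner_zero_left, mul_zero,
        mul_zero, neg_zero]
      positivity
  rw [integral_neg, hibp, neg_neg, integral_add (hFi.const_mul _) (hGi.const_mul _),
    integral_const_mul, integral_const_mul] at hle
  linarith

theorem IsTestFunction.mono {D U : Set (EuclideanSpace ℝ (Fin d))} (hDU : D ⊆ U)
    {φ : EuclideanSpace ℝ (Fin d) → ℂ} (hφ : IsTestFunction D φ) : IsTestFunction U φ :=
  ⟨hφ.1, hφ.2.1, hφ.2.2.trans hDU⟩

/-- Poincaré's inequality on `H¹₀(D)`, with one partial derivative. -/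
theorem norm_fst_le_of_mem_H10 {D : Set (EuclideanSpace ℝ (Fin d))} (hDY : D ⊆ unitCell d)
    (i : Fin d) {q : Jet D} (hq : q ∈ H10 D) : ‖q.1‖ ≤ 2 * ‖q.2 i‖ := by
  have hcl : IsClosed {q : Jet D | ‖q.1‖ ≤ 2 * ‖q.2 i‖} :=
    isClosed_le (by fun_prop) (by fun_prop)
  have hsub : testJets D ⊆ {q : Jet D | ‖q.1‖ ≤ 2 * ‖q.2 i‖} := by
    rintro p ⟨φ, hφ, h₁, h₂⟩
    have e₁ : ‖p.1‖ ^ 2 = ∫ x, ‖φ x‖ ^ 2 := by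
      rw [norm_sq_eq_integral_norm_sq, integral_congr_ae
        (show (fun x => ‖p.1 x‖ ^ 2) =ᵐ[volume.restrict D] fun x => ‖φ x‖ ^ 2 by
          filter_upwards [h₁] with x hx; rw [hx])]
      refine setIntegral_eq_integral_of_forall_compl_eq_zero fun x hx => ?_
      rw [image_eq_zero_of_notMem_tsupport fun h => hx (hφ.2.2 h)]
      simp
    have e₂ : ‖p.2 i‖ ^ 2 = ∫ x, ‖partialDeriv i φ x‖ ^ 2 := by
      rw [norm_sq_eq_integral_norm_sq, integral_congr_ae
        (show (fun x => ‖p.2 i x‖ ^ 2) =ᵐ[volume.restrict D] fun x => ‖partialDeriv i φ x‖ ^ 2 by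
          filter_upwards [h₂ i] with x hx; rw [hx])]
      refine setIntegral_eq_integral_of_forall_compl_eq_zero fun x hx => ?_
      rw [Function.notMem_support.mp fun h => hx (hφ.2.2 (support_partialDeriv_subset φ i h))]
      simp
    have h := integral_norm_sq_le_of_isTestFunction (hφ.mono hDY) i
    rw [← e₁, ← e₂] at h
    refine (sq_le_sq₀ (norm_nonneg _) (by positivity)).1 ?_
    linarith
  exact closure_minimal hsub hcl hq

theorem norm_apply_le_norm_toLp {X ι : Type*} [NormedAddCommGroup X] [Fintype ι]
    (g : ι → X) (i : ι) : ‖g i‖ ≤ ‖WithLp.toLp 2 g‖ :=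
  PiLp.norm_apply_le (WithLp.toLp 2 g) i

end DirichletPoincare

/-! ### Integration by parts against product functions on the cell -/

section Product

variable {d : ℕ}

/-- The product function `x ↦ ∏ⱼ fⱼ(xⱼ)`. -/
def tensor (f : Fin d → ℝ → ℂ) : EuclideanSpace ℝ (Fin d) → ℂ := fun x => ∏ j, f j (x j)

theorem tensor_update (f : Fin d → ℝ → ℂ) (i : Fin d) (h : ℝ → ℂ) (x : EuclideanSpace ℝ (Fin d)) :
    tensor (Function.update f i h) x = h (x i) * ∏ j ∈ Finset.univ.erase i, f j (x j) := by
  rw [tensor, ← Finset.mul_prod_erase _ _ (Finset.mem_univ i), Function.update_self]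
  congr 1
  refine Finset.prod_congr rfl fun j hj => ?_
  rw [Function.update_of_ne (Finset.ne_of_mem_erase hj)]

theorem tensor_update_smul (f : Fin d → ℝ → ℂ) (i : Fin d) (c : ℂ) (h : ℝ → ℂ)
    (x : EuclideanSpace ℝ (Fin d)) :
    tensor (Function.update f i fun t => c * h t) x = c * tensor (Function.update f i h) x := by
  rw [tensor_update, tensor_update, mul_assoc]

theorem contDiff_tensor {f : Fin d → ℝ → ℂ} (hf : ∀ j, ContDiff ℝ ∞ (f j)) :
    ContDiff ℝ ∞ (tensor f) :=
  contDiff_prod fun j _ =>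
    (hf j).comp (EuclideanSpace.proj j : EuclideanSpace ℝ (Fin d) →L[ℝ] ℝ).contDiff

theorem continuous_tensor {f : Fin d → ℝ → ℂ} (hf : ∀ j, Continuous (f j)) :
    Continuous (tensor f) :=
  continuous_finsetProd _ fun j _ => (hf j).comp (by fun_prop)

theorem partialDeriv_tensor {f : Fin d → ℝ → ℂ} (hf : ∀ j, ContDiff ℝ ∞ (f j)) (i : Fin d)
    (x : EuclideanSpace ℝ (Fin d)) :
    partialDeriv i (tensor f) x = tensor (Function.update f i (deriv (f i))) x := by
  have h1 : ∀ j, HasFDerivAt (fun x : EuclideanSpace ℝ (Fin d) => f j (x j))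
      ((ContinuousLinearMap.toSpanSingleton ℝ (deriv (f j) (x j))).comp
        (EuclideanSpace.proj j : EuclideanSpace ℝ (Fin d) →L[ℝ] ℝ)) x := fun j =>
    ((hf j).differentiable (by simp) (x j)).hasDerivAt.hasFDerivAt.comp x
      (EuclideanSpace.proj j : EuclideanSpace ℝ (Fin d) →L[ℝ] ℝ).hasFDerivAt
  have h2 := HasFDerivAt.finsetProd (u := Finset.univ) fun j _ => h1 j
  have h3 : fderiv ℝ (tensor f) x = _ := HasFDerivAt.fderiv h2
  rw [partialDeriv, h3, tensor_update, sum_apply, Finset.sum_eq_single i]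
  · simp [mul_comm]
  · intro j _ hj
    simp [hj]
  · simp

theorem measurableSet_unitCell (d : ℕ) : MeasurableSet (unitCell d) := by
  have : unitCell d = ⋂ i, {x | 0 < x i ∧ x i < 1} := by
    ext x
    simp [unitCell]
  rw [this]
  refine MeasurableSet.iInter fun i => ?_
  have hi : Measurable fun x : EuclideanSpace ℝ (Fin d) => x i := by fun_prop
  exact (measurableSet_lt measurable_const hi).inter (measurableSet_lt hi measurable_const)

/-- Dominated convergence for bounded product functions; only the values of the factors on `(0,1)`
matter. -/
theorem tendsto_integral_mul_tensor {F : ℕ → Fin d → ℝ → ℂ} {f : Fin d → ℝ → ℂ} {B : ℝ}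
    (hF : ∀ n j, Continuous (F n j))
    (hB : ∀ n j, ∀ t ∈ Set.Ioo (0 : ℝ) 1, ‖F n j t‖ ≤ B)
    (hlim : ∀ j, ∀ t ∈ Set.Ioo (0 : ℝ) 1,
      Filter.Tendsto (fun n => F n j t) Filter.atTop (nhds (f j t))) (u : L2 (unitCell d)) :
    Filter.Tendsto (fun n => ∫ x in unitCell d, u x * tensor (F n) x) Filter.atTop
      (nhds (∫ x in unitCell d, u x * tensor f x)) := by
  have := isFiniteMeasure_unitCell d
  have hu : Integrable u (volume.restrict (unitCell d)) := (Lp.memLp u).integrable (by norm_num)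
  refine tendsto_integral_of_dominated_convergence (fun x => ‖u x‖ * B ^ d) (fun n => ?_)
    (hu.norm.mul_const _) (fun n => ?_) ?_
  · exact hu.aestronglyMeasurable.mul (continuous_tensor (hF n)).aestronglyMeasurable
  · refine (ae_restrict_iff' (measurableSet_unitCell d)).2
      (Filter.Eventually.of_forall fun x hx => ?_)
    rw [norm_mul]
    refine mul_le_mul_of_nonneg_left ?_ (norm_nonneg _)
    rw [tensor, norm_prod]
    calc ∏ j, ‖F n j (x j)‖ ≤ ∏ _j : Fin d, B :=
          Finset.prod_le_prod (fun _ _ => norm_nonneg _) fun j _ => hB n j _ (hx j)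
      _ = B ^ d := by simp
  · refine (ae_restrict_iff' (measurableSet_unitCell d)).2
      (Filter.Eventually.of_forall fun x hx => ?_)
    exact (tendsto_finsetProd _ fun j _ => hlim j _ (hx j)).const_mul _

/-- A smooth function of `t` that vanishes unless `n t (1 - t) ≥ 1`, and is `1` for
`n t (1 - t) ≥ 2`. -/
noncomputable def cutoff (n : ℕ) (t : ℝ) : ℝ := Real.smoothTransition (n * (t * (1 - t)) - 1)

theorem contDiff_cutoff (n : ℕ) : ContDiff ℝ ∞ (cutoff n) :=
  Real.smoothTransition.contDiff.comp (by fun_prop)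

theorem cutoff_eq_zero {n : ℕ} {t : ℝ} (h : n * (t * (1 - t)) ≤ 1) : cutoff n t = 0 :=
  Real.smoothTransition.zero_of_nonpos (by linarith)

theorem cutoff_eq_one {n : ℕ} {t : ℝ} (h : 2 ≤ n * (t * (1 - t))) : cutoff n t = 1 :=
  Real.smoothTransition.one_of_one_le (by linarith)

theorem abs_cutoff_le_one (n : ℕ) (t : ℝ) : |cutoff n t| ≤ 1 := by
  rw [cutoff, abs_of_nonneg (Real.smoothTransition.nonneg _)]
  exact Real.smoothTransition.le_one _

theorem deriv_cutoff (n : ℕ) (t : ℝ) : deriv (cutoff n) t =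
    deriv Real.smoothTransition (n * (t * (1 - t)) - 1) * (n * (1 - 2 * t)) := by
  have h1 : HasDerivAt (fun t : ℝ => n * (t * (1 - t)) - 1) (n * (1 - 2 * t)) t := by
    have := (((hasDerivAt_id' t).mul ((hasDerivAt_id' t).const_sub 1)).const_mul
      (n : ℝ)).sub_const 1
    rw [show (n : ℝ) * (1 - 2 * t) = n * (1 * (1 - t) + t * -1) by ring]
    exact this
  have h2 := (Real.smoothTransition.contDiff (n := 1)).differentiable (by simp)
    (n * (t * (1 - t)) - 1)
  exact (h2.hasDerivAt.comp t h1).deriv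

theorem deriv_smoothTransition_of_one_lt {y : ℝ} (hy : 1 < y) :
    deriv Real.smoothTransition y = 0 := by
  have : Real.smoothTransition =ᶠ[nhds y] fun _ => 1 := by
    filter_upwards [lt_mem_nhds hy] with z hz
    exact Real.smoothTransition.one_of_one_le hz.le
  rw [this.deriv_eq, deriv_const]

theorem deriv_smoothTransition_of_neg {y : ℝ} (hy : y < 0) :
    deriv Real.smoothTransition y = 0 := by
  have : Real.smoothTransition =ᶠ[nhds y] fun _ => 0 := by
    filter_upwards [gt_mem_nhds hy] with z hz
    exact Real.smoothTransition.zero_of_nonpos hz.le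
  rw [this.deriv_eq, deriv_const]

theorem exists_bound_mul_deriv_smoothTransition :
    ∃ C, ∀ y : ℝ, |(y + 1) * deriv Real.smoothTransition y| ≤ C := by
  have hc : Continuous (deriv Real.smoothTransition) :=
    (Real.smoothTransition.contDiff (n := 1)).continuous_deriv (by simp)
  obtain ⟨C, hC⟩ := (isCompact_Icc (a := (0 : ℝ)) (b := 1)).exists_bound_of_continuousOn
    (f := fun y => (y + 1) * deriv Real.smoothTransition y) (by fun_prop)
  have hC0 : 0 ≤ C := (norm_nonneg _).trans (hC 0 (by simp))
  refine ⟨C, fun y => ?_⟩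
  rcases lt_or_ge y 0 with h | h
  · simpa [deriv_smoothTransition_of_neg h]
  rcases lt_or_ge 1 y with h' | h'
  · simpa [deriv_smoothTransition_of_one_lt h']
  · exact hC y ⟨h, h'⟩

/-- The derivative of the cutoff is of the order of the inverse distance to the boundary. -/
theorem exists_bound_mul_deriv_cutoff :
    ∃ C, ∀ n : ℕ, ∀ t ∈ Set.Ioo (0 : ℝ) 1, t * (1 - t) * |deriv (cutoff n) t| ≤ C := by
  obtain ⟨C, hC⟩ := exists_bound_mul_deriv_smoothTransition
  refine ⟨C, fun n t ht => ?_⟩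
  have h := hC (n * (t * (1 - t)) - 1)
  have h1 : 0 < t * (1 - t) := mul_pos ht.1 (by linarith [ht.2])
  rw [deriv_cutoff]
  nth_rewrite 1 [← abs_of_pos h1]
  rw [← abs_mul, show t * (1 - t) *
      (deriv Real.smoothTransition (n * (t * (1 - t)) - 1) * (n * (1 - 2 * t)))
    = ((n * (t * (1 - t)) - 1 + 1) * deriv Real.smoothTransition (n * (t * (1 - t)) - 1)) *
      (1 - 2 * t) by ring, abs_mul]
  have h2 : |1 - 2 * t| ≤ 1 := abs_le.2 ⟨by linarith [ht.2], by linarith [ht.1]⟩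
  nlinarith [abs_nonneg ((n * (t * (1 - t)) - 1 + 1) *
    deriv Real.smoothTransition (n * (t * (1 - t)) - 1))]

theorem eventually_lt_mul {t : ℝ} (ht : t ∈ Set.Ioo (0 : ℝ) 1) :
    ∀ᶠ n : ℕ in Filter.atTop, 2 < n * (t * (1 - t)) := by
  have h1 : 0 < t * (1 - t) := mul_pos ht.1 (by linarith [ht.2])
  exact (tendsto_natCast_atTop_atTop.atTop_mul_const h1).eventually_gt_atTop 2

theorem isTestFunction_tensor_cutoff {f : Fin d → ℝ → ℂ} (hf : ∀ j, ContDiff ℝ ∞ (f j)) (n : ℕ) :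
    IsTestFunction (unitCell d) (tensor fun j t => (cutoff n t : ℂ) * f j t) := by
  let S : Set (EuclideanSpace ℝ (Fin d)) := {x | ∀ j, 1 ≤ n * (x j * (1 - x j))}
  have hSY : S ⊆ unitCell d := by
    intro x hx j
    have h : 0 < x j * (1 - x j) :=
      (pos_iff_pos_of_mul_pos (lt_of_lt_of_le one_pos (hx j))).1 <| by
        rcases (Nat.cast_nonneg (α := ℝ) n).eq_or_lt with h0 | h0
        · have := hx j
          rw [← h0] at this
          linarith
        · exact h0
    constructor <;> nlinarith
  have hScl : IsClosed S := by
    have : S = ⋂ j, {x : EuclideanSpace ℝ (Fin d) | 1 ≤ n * (x j * (1 - x j))} := by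
      ext x
      simp [S]
    rw [this]
    exact isClosed_iInter fun j => isClosed_le continuous_const (by fun_prop)
  have hbd : Bornology.IsBounded (unitCell d) := by
    refine (Metric.isBounded_closedBall (x := (0 : EuclideanSpace ℝ (Fin d)))
      (r := Real.sqrt d)).subset fun x hx => ?_
    rw [mem_closedBall_zero_iff, EuclideanSpace.norm_eq]
    refine Real.sqrt_le_sqrt ?_
    calc ∑ i, ‖x i‖ ^ 2 ≤ ∑ _i : Fin d, (1 : ℝ) := Finset.sum_le_sum fun i _ => by
          rw [Real.norm_eq_abs, sq_abs]
          nlinarith [hx i]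
      _ = d := by simp
  have hsupp : Function.support (tensor fun j t => (cutoff n t : ℂ) * f j t) ⊆ S := by
    intro x hx j
    by_contra hlt
    refine hx (Finset.prod_eq_zero (Finset.mem_univ j) ?_)
    simp [cutoff_eq_zero (not_le.1 hlt).le]
  have hts : tsupport (tensor fun j t => (cutoff n t : ℂ) * f j t) ⊆ S :=
    closure_minimal hsupp hScl
  refine ⟨contDiff_tensor fun j => ?_, ?_, hts.trans hSY⟩
  · exact (Complex.ofRealCLM.contDiff.comp (contDiff_cutoff n)).mul (hf j)
  · exact (Metric.isCompact_of_isClosed_isBounded hScl (hbd.subset hSY)).of_isClosed_subset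
      (isClosed_tsupport _) hts

theorem deriv_cutoff_mul {f : ℝ → ℂ} (hf : ContDiff ℝ ∞ f) (n : ℕ) (t : ℝ) :
    deriv (fun t => (cutoff n t : ℂ) * f t) t =
      ((deriv (cutoff n) t : ℝ) : ℂ) * f t + (cutoff n t : ℂ) * deriv f t := by
  have h1 := ((contDiff_cutoff n).differentiable (by simp) t).hasDerivAt.ofReal_comp
  exact (h1.mul (hf.differentiable (by simp) t).hasDerivAt).deriv

/-- The weak derivative can be tested against a smooth product function whose `i`-th factor
vanishes at the two ends of the interval: the other factors are cut off without being
differentiated. -/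
theorem integral_mul_deriv_tensor {p : Jet (unitCell d)} (hp : p ∈ H1 (unitCell d))
    {f : Fin d → ℝ → ℂ} (hf : ∀ j, ContDiff ℝ ∞ (f j)) (i : Fin d) (M : ℝ)
    (hM : ∀ t ∈ Set.Ioo (0 : ℝ) 1, ‖f i t‖ ≤ M * (t * (1 - t))) :
    ∫ x in unitCell d, p.1 x * tensor (Function.update f i (deriv (f i))) x =
      - ∫ x in unitCell d, p.2 i x * tensor f x := by
  have hdc : Continuous (deriv (f i)) := (hf i).continuous_deriv (by simp)
  have hbound : ∀ g : ℝ → ℂ, Continuous g → ∃ B, ∀ t ∈ Set.Ioo (0 : ℝ) 1, ‖g t‖ ≤ B := by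
    intro g hg
    obtain ⟨B, hB⟩ := (isCompact_Icc (a := (0 : ℝ)) (b := 1)).exists_bound_of_continuousOn
      hg.continuousOn
    exact ⟨B, fun t ht => hB t (Set.Ioo_subset_Icc_self ht)⟩
  choose B hB using fun j => hbound (f j) (hf j).continuous
  obtain ⟨B', hB'⟩ := hbound _ hdc
  obtain ⟨C, hC⟩ := exists_bound_mul_deriv_cutoff
  have hhalf : (1 / 2 : ℝ) ∈ Set.Ioo (0 : ℝ) 1 := by norm_num
  have hB0 : ∀ j, 0 ≤ B j := fun j => (norm_nonneg _).trans (hB j _ hhalf)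
  have hM0 : 0 ≤ M := by
    have := (norm_nonneg _).trans (hM _ hhalf)
    linarith
  have hC0 : 0 ≤ C := le_trans (by positivity) (hC 0 _ hhalf)
  have hcut : ∀ n t (z : ℂ), ‖(cutoff n t : ℂ) * z‖ ≤ ‖z‖ := fun n t z => by
    rw [norm_mul, Complex.norm_real, Real.norm_eq_abs]
    exact mul_le_of_le_one_left (norm_nonneg _) (abs_cutoff_le_one n t)
  have hcc : ∀ n j, ContDiff ℝ ∞ fun t => (cutoff n t : ℂ) * f j t := fun n j =>
    (Complex.ofRealCLM.contDiff.comp (contDiff_cutoff n)).mul (hf j)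
  have hle : ∀ j, B j ≤ ∑ l, B l + (M * C + B') := fun j => by
    have h1 := Finset.single_le_sum (fun l _ => hB0 l) (Finset.mem_univ j)
    have h2 : 0 ≤ B' := (norm_nonneg _).trans (hB' _ hhalf)
    nlinarith [mul_nonneg hM0 hC0]
  have hle' : M * C + B' ≤ ∑ l, B l + (M * C + B') := by
    linarith [Finset.sum_nonneg fun l (_ : l ∈ Finset.univ) => hB0 l]
  have hlim : ∀ j, ∀ t ∈ Set.Ioo (0 : ℝ) 1, Filter.Tendsto (fun n => (cutoff n t : ℂ) * f j t)
      Filter.atTop (nhds (f j t)) := by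
    intro j t ht
    refine tendsto_const_nhds.congr' ?_
    filter_upwards [eventually_lt_mul ht] with n hn
    rw [cutoff_eq_one hn.le]
    simp
  have lim₁ := tendsto_integral_mul_tensor (F := fun n j t => (cutoff n t : ℂ) * f j t) (f := f)
    (fun n j => (hcc n j).continuous)
    (fun n j t ht => (hcut n t _).trans ((hB j t ht).trans (hle j))) hlim (p.2 i)
  have lim₂ := tendsto_integral_mul_tensor
    (F := fun n => Function.update (fun j t => (cutoff n t : ℂ) * f j t) i
      (deriv fun t => (cutoff n t : ℂ) * f i t))
    (f := Function.update f i (deriv (f i))) (B := ∑ l, B l + (M * C + B'))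
    (fun n j => by
      rcases eq_or_ne j i with rfl | h
      · rw [Function.update_self]
        exact (hcc n j).continuous_deriv (by simp)
      · rw [Function.update_of_ne h]
        exact (hcc n j).continuous)
    (fun n j t ht => by
      rcases eq_or_ne j i with rfl | h
      · rw [Function.update_self, deriv_cutoff_mul (hf j)]
        refine (norm_add_le _ _).trans
          (le_trans (add_le_add ?_ ((hcut n t _).trans (hB' t ht))) hle')
        rw [norm_mul, Complex.norm_real, Real.norm_eq_abs]
        calc |deriv (cutoff n) t| * ‖f j t‖ ≤ |deriv (cutoff n) t| * (M * (t * (1 - t))) := by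
              gcongr
              exact hM t ht
          _ = M * (t * (1 - t) * |deriv (cutoff n) t|) := by ring
          _ ≤ M * C := by
              gcongr
              exact hC n t ht
      · rw [Function.update_of_ne h]
        exact (hcut n t _).trans ((hB j t ht).trans (hle j)))
    (fun j t ht => by
      rcases eq_or_ne j i with rfl | h
      · simp only [Function.update_self]
        refine tendsto_const_nhds.congr' ?_
        filter_upwards [eventually_lt_mul ht] with n hn
        rw [deriv_cutoff_mul (hf j), deriv_cutoff,
          deriv_smoothTransition_of_one_lt (by linarith), cutoff_eq_one hn.le]
        simp
      · simp only [Function.update_of_ne h]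
        exact hlim j t ht)
    p.1
  refine tendsto_nhds_unique lim₂ (lim₁.neg.congr fun n => ?_)
  rw [← hp i _ (isTestFunction_tensor_cutoff hf n)]
  refine integral_congr_ae (Filter.Eventually.of_forall fun x => ?_)
  dsimp only
  rw [partialDeriv_tensor (hcc n)]

end Product

/-! ### Completeness of the product cosines -/

section Completeness

variable {d : ℕ}

/-- `t ↦ cos (π k t)`, complex valued. -/
noncomputable def cosFactor (k : ℕ) (t : ℝ) : ℂ := (Real.cos (Real.pi * k * t) : ℝ)

/-- `t ↦ sin (π k t)`, complex valued. -/
noncomputable def sinFactor (k : ℕ) (t : ℝ) : ℂ := (Real.sin (Real.pi * k * t) : ℝ)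

/-- `∏ⱼ cos (π kⱼ yⱼ)` as a continuous function on the closed cube. -/
noncomputable def cubeCos (k : Fin d → ℕ) : C(Fin d → unitInterval, ℝ) where
  toFun y := ∏ j, Real.cos (Real.pi * k j * y j)
  continuous_toFun := by fun_prop

/-- `cos (π yᵢ)` as a continuous function on the closed cube. -/
noncomputable def cubeCoord (i : Fin d) : C(Fin d → unitInterval, ℝ) where
  toFun y := Real.cos (Real.pi * y i)
  continuous_toFun := by fun_prop

theorem cubeCos_update_apply (k : Fin d → ℕ) (i : Fin d) (a : ℕ) (y : Fin d → unitInterval) :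
    cubeCos (Function.update k i a) y = Real.cos (Real.pi * a * y i) *
      ∏ j ∈ Finset.univ.erase i, Real.cos (Real.pi * k j * y j) := by
  change ∏ j, Real.cos (Real.pi * (Function.update k i a j : ℕ) * y j) = _
  rw [← Finset.mul_prod_erase _ _ (Finset.mem_univ i), Function.update_self]
  congr 1
  refine Finset.prod_congr rfl fun j hj => ?_
  rw [Function.update_of_ne (Finset.ne_of_mem_erase hj)]

/-- By `2 cos a cos b = cos (a + b) + cos (a - b)`. -/
theorem cubeCoord_mul_cubeCos_mem (i : Fin d) (k : Fin d → ℕ) :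
    cubeCoord i * cubeCos k ∈ Submodule.span ℝ (Set.range (cubeCos (d := d))) := by
  have hmem : ∀ a, cubeCos (Function.update k i a) ∈
      Submodule.span ℝ (Set.range (cubeCos (d := d))) := fun a =>
    Submodule.subset_span ⟨_, rfl⟩
  have hk : ∀ y, cubeCos k y = Real.cos (Real.pi * k i * y i) *
      ∏ j ∈ Finset.univ.erase i, Real.cos (Real.pi * k j * y j) := fun y => by
    rw [← cubeCos_update_apply, Function.update_eq_self]
  rcases hki : k i with _ | s
  · convert hmem 1 using 1
    ext y
    rw [ContinuousMap.mul_apply, hk, cubeCos_update_apply, hki]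
    simp [cubeCoord]
  · have h := Submodule.smul_mem _ (1 / 2 : ℝ) (Submodule.add_mem _ (hmem (s + 2)) (hmem s))
    convert h using 1
    ext y
    rw [ContinuousMap.mul_apply, hk, ContinuousMap.smul_apply, ContinuousMap.add_apply,
      cubeCos_update_apply, cubeCos_update_apply, hki]
    have h1 : Real.pi * ((s + 2 : ℕ) : ℝ) * (y i : ℝ) =
        Real.pi * ((s + 1 : ℕ) : ℝ) * y i + Real.pi * y i := by push_cast; ring
    have h2 : Real.pi * (s : ℝ) * (y i : ℝ) =
        Real.pi * ((s + 1 : ℕ) : ℝ) * y i - Real.pi * y i := by push_cast; ring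
    rw [h1, h2, Real.cos_add, Real.cos_sub]
    simp only [cubeCoord, ContinuousMap.coe_mk, smul_eq_mul]
    ring

theorem adjoin_cubeCoord_le_span :
    Subalgebra.toSubmodule (Algebra.adjoin ℝ (Set.range (cubeCoord (d := d)))) ≤
      Submodule.span ℝ (Set.range (cubeCos (d := d))) := by
  rw [Algebra.adjoin_eq_span, Submodule.span_le]
  intro f hf
  induction hf using Submonoid.closure_induction_left with
  | one =>
    refine Submodule.subset_span ⟨0, ?_⟩
    ext y
    simp [cubeCos]
  | mul_left x hx y _ hy =>
    obtain ⟨i, rfl⟩ := hx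
    refine Submodule.span_induction (p := fun g _ => cubeCoord i * g ∈
      Submodule.span ℝ (Set.range (cubeCos (d := d)))) ?_ ?_ ?_ ?_ hy
    · rintro _ ⟨k, rfl⟩
      exact cubeCoord_mul_cubeCos_mem i k
    · simp
    · intro a b _ _ ha hb
      rw [mul_add]
      exact Submodule.add_mem _ ha hb
    · intro c a _ ha
      rw [mul_smul_comm]
      exact Submodule.smul_mem _ c ha

/-- By the Stone-Weierstrass theorem, since `cos (π ·)` is injective on `[0,1]`. -/
theorem dense_span_cubeCos :
    Dense (Submodule.span ℝ (Set.range (cubeCos (d := d))) : Set C(Fin d → unitInterval, ℝ)) := by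
  have hsep : (Algebra.adjoin ℝ (Set.range (cubeCoord (d := d)))).SeparatesPoints := by
    intro x y hxy
    obtain ⟨i, hi⟩ := Function.ne_iff.1 hxy
    refine ⟨cubeCoord i, ⟨cubeCoord i, Algebra.subset_adjoin ⟨i, rfl⟩, rfl⟩, fun h => hi ?_⟩
    have hm : ∀ z : unitInterval, Real.pi * (z : ℝ) ∈ Set.Icc 0 Real.pi := fun z =>
      ⟨mul_nonneg Real.pi_pos.le z.2.1, mul_le_of_le_one_right Real.pi_pos.le z.2.2⟩
    have := Real.injOn_cos (hm (x i)) (hm (y i)) h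
    exact Subtype.ext (mul_left_cancel₀ Real.pi_ne_zero this)
  have h := ContinuousMap.subalgebra_topologicalClosure_eq_top_of_separatesPoints _ hsep
  refine Dense.mono (adjoin_cubeCoord_le_span (d := d)) ?_
  rw [dense_iff_closure_eq]
  exact congrArg
    (fun A : Subalgebra ℝ C(Fin d → unitInterval, ℝ) => (A : Set C(Fin d → unitInterval, ℝ))) h

/-- The retraction of the space onto the closed cube. -/
noncomputable def clamp (x : EuclideanSpace ℝ (Fin d)) : Fin d → unitInterval :=
  fun j => Set.projIcc 0 1 zero_le_one (x j)

theorem continuous_clamp : Continuous (clamp (d := d)) :=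
  continuous_pi fun j => continuous_projIcc.comp (by fun_prop)

theorem clamp_apply {x : EuclideanSpace ℝ (Fin d)} (hx : x ∈ unitCell d) (j : Fin d) :
    (clamp x j : ℝ) = x j := by
  rw [clamp, Set.projIcc_of_mem _ ⟨(hx j).1.le, (hx j).2.le⟩]

/-- The product `∏ⱼ cos (π kⱼ xⱼ)`, an eigenfunction of the Neumann Laplacian on the cell. -/
noncomputable def cosMode (k : Fin d → ℕ) : EuclideanSpace ℝ (Fin d) → ℂ :=
  tensor fun j => cosFactor (k j)

theorem cubeCos_clamp (k : Fin d → ℕ) {x : EuclideanSpace ℝ (Fin d)} (hx : x ∈ unitCell d) :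
    (cubeCos k (clamp x) : ℂ) = cosMode k x := by
  simp only [cubeCos, ContinuousMap.coe_mk, cosMode, tensor, cosFactor, clamp_apply hx]
  push_cast
  rfl

theorem ae_mem_unitCell (d : ℕ) : ∀ᵐ x ∂volume.restrict (unitCell d), x ∈ unitCell d :=
  ae_restrict_mem (measurableSet_unitCell d)

theorem isOpen_unitCell (d : ℕ) : IsOpen (unitCell d) := by
  have : unitCell d = ⋂ i, {x | 0 < x i ∧ x i < 1} := by
    ext x
    simp [unitCell]
  rw [this]
  refine isOpen_iInter_of_finite fun i => ?_
  have hi : Continuous fun x : EuclideanSpace ℝ (Fin d) => x i := by fun_prop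
  exact (isOpen_lt continuous_const hi).inter (isOpen_lt hi continuous_const)

theorem exists_clm_integral_mul_clamp (u : L2 (unitCell d)) :
    ∃ Λ : C(Fin d → unitInterval, ℝ) →L[ℝ] ℂ,
      ∀ f, Λ f = ∫ x in unitCell d, u x * (f (clamp x) : ℂ) := by
  have := isFiniteMeasure_unitCell d
  have hu : Integrable u (volume.restrict (unitCell d)) := (Lp.memLp u).integrable (by norm_num)
  have hc : ∀ f : C(Fin d → unitInterval, ℝ), Continuous fun x => (f (clamp x) : ℂ) := fun f =>
    Complex.continuous_ofReal.comp (f.continuous.comp continuous_clamp)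
  have hb : ∀ (f : C(Fin d → unitInterval, ℝ)) (x : EuclideanSpace ℝ (Fin d)),
      ‖(f (clamp x) : ℂ)‖ ≤ ‖f‖ := fun f x => by
    rw [Complex.norm_real]
    exact f.norm_coe_le_norm _
  have hint : ∀ f : C(Fin d → unitInterval, ℝ),
      Integrable (fun x => u x * (f (clamp x) : ℂ)) (volume.restrict (unitCell d)) := fun f =>
    hu.mul_bdd (c := ‖f‖) (hc f).aestronglyMeasurable (Filter.Eventually.of_forall (hb f))
  refine ⟨LinearMap.mkContinuous
    { toFun := fun f => ∫ x in unitCell d, u x * (f (clamp x) : ℂ)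
      map_add' := fun f g => ?_
      map_smul' := fun c f => ?_ } (∫ x in unitCell d, ‖u x‖) (fun f => ?_), fun f => rfl⟩
  · rw [← integral_add (hint f) (hint g)]
    congr 1
    ext x
    simp [mul_add]
  · rw [RingHom.id_apply, ← integral_smul]
    congr 1
    ext x
    simp only [ContinuousMap.smul_apply, smul_eq_mul, Complex.ofReal_mul, Complex.real_smul]
    ring
  · refine (norm_integral_le_integral_norm _).trans ?_
    rw [← integral_mul_const]
    refine integral_mono (hint f).norm (hu.norm.mul_const _) fun x => ?_
    change ‖u x * (f (clamp x) : ℂ)‖ ≤ ‖u x‖ * ‖f‖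
    rw [norm_mul]
    exact mul_le_mul_of_nonneg_left (hb f x) (norm_nonneg _)

/-- A square integrable function orthogonal to smooth compactly supported functions is zero. -/
theorem eq_zero_of_forall_integral_mul_eq_zero {U : Set (EuclideanSpace ℝ (Fin d))}
    (hU : IsOpen U) (u : L2 U)
    (h : ∀ φ, IsTestFunction U φ → ∫ x in U, u x * φ x = 0) : u = 0 := by
  have hloc : LocallyIntegrableOn u U volume := by
    refine (locallyIntegrableOn_iff hU.isLocallyClosed).2 fun K hKU hK => ?_
    have hm : MemLp u 2 (volume.restrict K) :=
      (Lp.memLp u).mono_measure (Measure.restrict_mono hKU le_rfl)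
    have : IsFiniteMeasure (volume.restrict K) := ⟨by simpa using hK.measure_lt_top⟩
    exact hm.integrable (by norm_num)
  have := hU.ae_eq_zero_of_integral_contDiff_smul_eq_zero hloc fun g hg hgc hgU => ?_
  · rw [Lp.eq_zero_iff_ae_eq_zero]
    exact (ae_restrict_iff' hU.measurableSet).2 this
  · have hs : Function.support (fun x => (g x : ℂ)) ⊆ Function.support g := fun x hx h =>
      hx (by simp [h])
    have htest : IsTestFunction U fun x => (g x : ℂ) :=
      ⟨Complex.ofRealCLM.contDiff.comp hg, hgc.comp_left Complex.ofReal_zero,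
        (closure_mono hs).trans hgU⟩
    have h0 := h _ htest
    rw [setIntegral_mul_eq_integral ((subset_tsupport _).trans htest.2.2)] at h0
    rw [← h0]
    congr 1
    ext x
    rw [Complex.real_smul, mul_comm]

theorem eq_zero_of_forall_integral_mul_cosMode_eq_zero (u : L2 (unitCell d))
    (h : ∀ k : Fin d → ℕ, ∫ x in unitCell d, u x * cosMode k x = 0) : u = 0 := by
  obtain ⟨Λ, hΛ⟩ := exists_clm_integral_mul_clamp u
  have hΛ0 : Λ = 0 := by
    refine ContinuousLinearMap.ext_on (dense_span_cubeCos (d := d)) ?_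
    rintro _ ⟨k, rfl⟩
    rw [hΛ, zero_apply, ← h k]
    refine integral_congr_ae ?_
    filter_upwards [ae_mem_unitCell d] with x hx
    rw [cubeCos_clamp k hx]
  have hre : ∀ g : EuclideanSpace ℝ (Fin d) → ℝ, Continuous g →
      ∫ x in unitCell d, u x * (g x : ℂ) = 0 := by
    intro g hg
    let G : C(Fin d → unitInterval, ℝ) :=
      ⟨fun y => g (WithLp.toLp 2 fun j => (y j : ℝ)), by fun_prop⟩
    have := hΛ G
    rw [hΛ0, zero_apply] at this
    rw [this]
    refine integral_congr_ae ?_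
    filter_upwards [ae_mem_unitCell d] with x hx
    have hxc : (WithLp.toLp 2 fun j => (clamp x j : ℝ)) = x := by
      ext j
      exact clamp_apply hx j
    simp only [G, ContinuousMap.coe_mk, hxc]
  refine eq_zero_of_forall_integral_mul_eq_zero (isOpen_unitCell d) u fun φ hφ => ?_
  have := isFiniteMeasure_unitCell d
  have hφc := hφ.1.continuous
  have hR := hre _ (Complex.continuous_re.comp hφc)
  have hI := hre _ (Complex.continuous_im.comp hφc)
  have hmem : ∀ g : EuclideanSpace ℝ (Fin d) → ℂ, Continuous g → HasCompactSupport g →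
      Integrable (fun x => u x * g x) (volume.restrict (unitCell d)) := fun g hg hgc =>
    (Lp.memLp u).integrable_mul (memLp_of_continuous_of_hasCompactSupport hg hgc _)
  have e : ∀ x, u x * φ x = u x * ((φ x).re : ℂ) + Complex.I * (u x * ((φ x).im : ℂ)) := by
    intro x
    conv_lhs => rw [← Complex.re_add_im (φ x)]
    ring
  simp_rw [e]
  rw [integral_add, integral_const_mul]
  · simp only [Function.comp_apply] at hR hI
    rw [hR, hI]
    simp
  · exact hmem _ (Complex.continuous_ofReal.comp (Complex.continuous_re.comp hφc))
      (hφ.2.1.comp_left (g := fun z : ℂ => (z.re : ℂ)) (by simp))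
  · exact (hmem _ (Complex.continuous_ofReal.comp (Complex.continuous_im.comp hφc))
      (hφ.2.1.comp_left (g := fun z : ℂ => (z.im : ℂ)) (by simp))).const_mul _

end Completeness

/-! ### The cosine basis and the Neumann problem on the cell -/

section Modes

variable {d : ℕ}

theorem contDiff_cosFactor (k : ℕ) : ContDiff ℝ ∞ (cosFactor k) :=
  Complex.ofRealCLM.contDiff.comp (Real.contDiff_cos.comp (by fun_prop))

theorem contDiff_sinFactor (k : ℕ) : ContDiff ℝ ∞ (sinFactor k) :=
  Complex.ofRealCLM.contDiff.comp (Real.contDiff_sin.comp (by fun_prop))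

theorem deriv_cosFactor (k : ℕ) :
    deriv (cosFactor k) = fun t => (-(Real.pi * k : ℝ) : ℂ) * sinFactor k t := by
  ext t
  have h : HasDerivAt (fun t : ℝ => Real.pi * k * t) (Real.pi * k) t := by
    simpa using (hasDerivAt_id t).const_mul (Real.pi * k)
  rw [show cosFactor k = fun t => ((Real.cos (Real.pi * k * t) : ℝ) : ℂ) from rfl,
    (h.cos.ofReal_comp).deriv, sinFactor]
  push_cast
  ring

theorem deriv_sinFactor (k : ℕ) :
    deriv (sinFactor k) = fun t => ((Real.pi * k : ℝ) : ℂ) * cosFactor k t := by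
  ext t
  have h : HasDerivAt (fun t : ℝ => Real.pi * k * t) (Real.pi * k) t := by
    simpa using (hasDerivAt_id t).const_mul (Real.pi * k)
  rw [show sinFactor k = fun t => ((Real.sin (Real.pi * k * t) : ℝ) : ℂ) from rfl,
    (h.sin.ofReal_comp).deriv, cosFactor]
  push_cast
  ring

theorem norm_sinFactor_le (k : ℕ) {t : ℝ} (ht : t ∈ Set.Ioo (0 : ℝ) 1) :
    ‖sinFactor k t‖ ≤ 2 * (Real.pi * k) * (t * (1 - t)) := by
  have hk : 0 ≤ Real.pi * k := by positivity
  have habs : ∀ s : ℝ, 0 ≤ s → |Real.sin (Real.pi * k * s)| ≤ Real.pi * k * s := fun s hs => by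
    refine Real.abs_sin_le_abs.trans (abs_of_nonneg ?_).le
    positivity
  rw [sinFactor, Complex.norm_real, Real.norm_eq_abs]
  rcases le_total t (1 / 2) with h | h
  · refine (habs t ht.1.le).trans ?_
    nlinarith [mul_nonneg hk (mul_nonneg ht.1.le (by linarith : 0 ≤ 1 - 2 * t))]
  · have h1 : |Real.sin (Real.pi * k * t)| = |Real.sin (Real.pi * k * (1 - t))| := by
      rw [show Real.pi * k * (1 - t) = k * Real.pi - Real.pi * k * t by ring,
        Real.sin_nat_mul_pi_sub, abs_neg, abs_mul, abs_pow]
      simp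
    rw [h1]
    refine (habs (1 - t) (by linarith [ht.2])).trans ?_
    nlinarith [mul_nonneg hk (mul_nonneg (by linarith [ht.2] : 0 ≤ 1 - t)
      (by linarith : 0 ≤ 2 * t - 1))]

/-- The product of `sin (π kᵢ xᵢ)` and of the `cos (π kⱼ xⱼ)`, `j ≠ i`. -/
noncomputable def sinMode (i : Fin d) (k : Fin d → ℕ) : EuclideanSpace ℝ (Fin d) → ℂ :=
  tensor (Function.update (fun j => cosFactor (k j)) i (sinFactor (k i)))

theorem contDiff_cosMode (k : Fin d → ℕ) : ContDiff ℝ ∞ (cosMode k) :=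
  contDiff_tensor fun j => contDiff_cosFactor (k j)

theorem contDiff_sinMode_factor (i : Fin d) (k : Fin d → ℕ) (j : Fin d) :
    ContDiff ℝ ∞ (Function.update (fun j => cosFactor (k j)) i (sinFactor (k i)) j) := by
  rcases eq_or_ne j i with rfl | h
  · rw [Function.update_self]
    exact contDiff_sinFactor _
  · rw [Function.update_of_ne h]
    exact contDiff_cosFactor _

theorem partialDeriv_cosMode (i : Fin d) (k : Fin d → ℕ) (x : EuclideanSpace ℝ (Fin d)) :
    partialDeriv i (cosMode k) x = (-(Real.pi * k i : ℝ) : ℂ) * sinMode i k x := by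
  rw [cosMode, partialDeriv_tensor fun j => contDiff_cosFactor (k j), deriv_cosFactor,
    tensor_update_smul, sinMode]

theorem norm_tensor_le_one {f : Fin d → ℝ → ℂ} (hf : ∀ j t, ‖f j t‖ ≤ 1)
    (x : EuclideanSpace ℝ (Fin d)) : ‖tensor f x‖ ≤ 1 := by
  rw [tensor, norm_prod]
  exact Finset.prod_le_one (fun _ _ => norm_nonneg _) fun j _ => hf j _

theorem norm_cosFactor_le_one (k : ℕ) (t : ℝ) : ‖cosFactor k t‖ ≤ 1 := by
  rw [cosFactor, Complex.norm_real]
  exact Real.abs_cos_le_one _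

theorem norm_sinFactor_le_one (k : ℕ) (t : ℝ) : ‖sinFactor k t‖ ≤ 1 := by
  rw [sinFactor, Complex.norm_real]
  exact Real.abs_sin_le_one _

theorem memLp_cosMode (k : Fin d → ℕ) : MemLp (cosMode k) 2 (volume.restrict (unitCell d)) := by
  have := isFiniteMeasure_unitCell d
  exact MemLp.of_bound (contDiff_cosMode k).continuous.aestronglyMeasurable 1
    (Filter.Eventually.of_forall (norm_tensor_le_one fun j => norm_cosFactor_le_one (k j)))

theorem memLp_sinMode (i : Fin d) (k : Fin d → ℕ) :
    MemLp (sinMode i k) 2 (volume.restrict (unitCell d)) := by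
  have := isFiniteMeasure_unitCell d
  refine MemLp.of_bound (contDiff_tensor
    (contDiff_sinMode_factor i k)).continuous.aestronglyMeasurable 1
    (Filter.Eventually.of_forall (norm_tensor_le_one fun j t => ?_))
  rcases eq_or_ne j i with rfl | h
  · rw [Function.update_self]
    exact norm_sinFactor_le_one _ _
  · rw [Function.update_of_ne h]
    exact norm_cosFactor_le_one _ _

theorem conj_tensor {f : Fin d → ℝ → ℂ} (hf : ∀ j t, conj (f j t) = f j t)
    (x : EuclideanSpace ℝ (Fin d)) : conj (tensor f x) = tensor f x := by
  rw [tensor, map_prod]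
  exact Finset.prod_congr rfl fun j _ => hf j _

theorem conj_cosMode (k : Fin d → ℕ) (x : EuclideanSpace ℝ (Fin d)) :
    conj (cosMode k x) = cosMode k x :=
  conj_tensor (fun _ _ => Complex.conj_ofReal _) x

theorem conj_sinMode (i : Fin d) (k : Fin d → ℕ) (x : EuclideanSpace ℝ (Fin d)) :
    conj (sinMode i k x) = sinMode i k x := by
  refine conj_tensor (fun j t => ?_) x
  rcases eq_or_ne j i with rfl | h
  · rw [Function.update_self]
    exact Complex.conj_ofReal _
  · rw [Function.update_of_ne h]
    exact Complex.conj_ofReal _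

/-- `cosMode k` as an element of `L²(Y)`. -/
noncomputable def cosLp (k : Fin d → ℕ) : L2 (unitCell d) := (memLp_cosMode k).toLp _

/-- `sinMode i k` as an element of `L²(Y)`. -/
noncomputable def sinLp (i : Fin d) (k : Fin d → ℕ) : L2 (unitCell d) := (memLp_sinMode i k).toLp _

theorem inner_toLp_eq_integral_mul {α : Type*} [MeasurableSpace α] {μ : Measure α} {f : α → ℂ}
    (hf : MemLp f 2 μ) (hr : ∀ x, conj (f x) = f x) (u : Lp ℂ 2 μ) :
    inner ℂ (hf.toLp f) u = ∫ x, u x * f x ∂μ := by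
  rw [L2.inner_def]
  refine integral_congr_ae ?_
  filter_upwards [hf.coeFn_toLp] with x hx
  rw [hx, RCLike.inner_apply, hr]

theorem inner_cosLp (k : Fin d → ℕ) (u : L2 (unitCell d)) :
    inner ℂ (cosLp k) u = ∫ x in unitCell d, u x * cosMode k x :=
  inner_toLp_eq_integral_mul (memLp_cosMode k) (conj_cosMode k) u

theorem inner_sinLp (i : Fin d) (k : Fin d → ℕ) (u : L2 (unitCell d)) :
    inner ℂ (sinLp i k) u = ∫ x in unitCell d, u x * sinMode i k x :=
  inner_toLp_eq_integral_mul (memLp_sinMode i k) (conj_sinMode i k) u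

/-- The cosine coefficients of a function determine the sine coefficients of its weak
derivatives. -/
theorem mul_inner_cosLp {p : Jet (unitCell d)} (hp : p ∈ H1 (unitCell d)) (i : Fin d)
    (k : Fin d → ℕ) :
    ((Real.pi * k i : ℝ) : ℂ) * inner ℂ (cosLp k) p.1 = - inner ℂ (sinLp i k) (p.2 i) := by
  have h := integral_mul_deriv_tensor hp (contDiff_sinMode_factor i k) i (2 * (Real.pi * k i))
    fun t ht => by
      rw [Function.update_self]
      exact norm_sinFactor_le _ ht
  rw [inner_cosLp, inner_sinLp]
  refine Eq.trans ?_ h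
  rw [← integral_const_mul]
  congr 1
  ext x
  rw [Function.update_self, Function.update_idem, deriv_sinFactor, tensor_update_smul,
    Function.update_eq_self i fun j => cosFactor (k j), cosMode]
  ring

/-- The pair `(c, ∇c)` for the cosine mode `c`. -/
noncomputable def cosJet (k : Fin d → ℕ) : Jet (unitCell d) :=
  (cosLp k, fun i => (-(Real.pi * k i : ℝ) : ℂ) • sinLp i k)

theorem cosJet_mem_H1 (k : Fin d → ℕ) : cosJet k ∈ H1 (unitCell d) := by
  refine mem_H1_of_contDiff (contDiff_cosMode k) (memLp_cosMode k).coeFn_toLp fun i => ?_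
  refine (Lp.coeFn_smul _ _).trans ?_
  filter_upwards [(memLp_sinMode i k).coeFn_toLp] with x hx
  rw [partialDeriv_cosMode, Pi.smul_apply, sinLp, hx, smul_eq_mul]

theorem mul_inner_cosLp_cosLp (i : Fin d) (k l : Fin d → ℕ) :
    (k i : ℂ) * inner ℂ (cosLp k) (cosLp l) = l i * inner ℂ (sinLp i k) (sinLp i l) := by
  have h := mul_inner_cosLp (cosJet_mem_H1 l) i k
  have h' : ((Real.pi * k i : ℝ) : ℂ) * inner ℂ (cosLp k) (cosLp l) =
      ((Real.pi * l i : ℝ) : ℂ) * inner ℂ (sinLp i k) (sinLp i l) := by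
    refine h.trans ?_
    change - inner ℂ (sinLp i k) ((-(Real.pi * l i : ℝ) : ℂ) • sinLp i l) = _
    rw [inner_smul_right]
    ring
  have hpi : (Real.pi : ℂ) ≠ 0 := by exact_mod_cast Real.pi_ne_zero
  refine mul_left_cancel₀ hpi ?_
  push_cast at h'
  linear_combination h'

/-- `kᵢ² (cₖ, cₗ) = kᵢ lᵢ (sₖ, sₗ) = lᵢ² (cₖ, cₗ)`. -/
theorem inner_cosLp_of_ne {k l : Fin d → ℕ} (h : k ≠ l) : inner ℂ (cosLp k) (cosLp l) = 0 := by
  obtain ⟨i, hi⟩ := Function.ne_iff.1 h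
  have h1 := mul_inner_cosLp_cosLp i k l
  have h2 := congrArg conj (mul_inner_cosLp_cosLp i l k)
  simp only [map_mul, inner_conj_symm, map_natCast] at h2
  have h3 : ((k i : ℂ) ^ 2 - (l i : ℂ) ^ 2) * inner ℂ (cosLp k) (cosLp l) = 0 := by
    linear_combination (k i : ℂ) * h1 - (l i : ℂ) * h2
  refine (mul_eq_zero.1 h3).resolve_left fun h0 => hi ?_
  have h4 : k i ^ 2 = l i ^ 2 := by exact_mod_cast sub_eq_zero.1 h0
  exact Nat.pow_left_injective (n := 2) (by norm_num) h4

theorem cosLp_ne_zero (k : Fin d → ℕ) : cosLp k ≠ 0 := by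
  intro h
  have h0 : cosMode k =ᵐ[volume.restrict (unitCell d)] fun _ => 0 :=
    (memLp_cosMode k).coeFn_toLp.symm.trans ((Lp.eq_zero_iff_ae_eq_zero).1 h)
  have h1 := Measure.eqOn_open_of_ae_eq h0 (isOpen_unitCell d)
    (contDiff_cosMode k).continuous.continuousOn continuousOn_const
  -- At this point of the cell all factors are cosines of angles below a right angle.
  let x : EuclideanSpace ℝ (Fin d) := WithLp.toLp 2 fun j => 1 / (2 * ((k j : ℝ) + 1))
  have hx : x ∈ unitCell d := fun j => by
    change 0 < 1 / (2 * ((k j : ℝ) + 1)) ∧ 1 / (2 * ((k j : ℝ) + 1)) < 1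
    refine ⟨by positivity, ?_⟩
    rw [div_lt_one (by positivity)]
    linarith [Nat.cast_nonneg (α := ℝ) (k j)]
  have h2 : ∏ j, cosFactor (k j) (x j) = 0 := h1 hx
  rw [Finset.prod_eq_zero_iff] at h2
  obtain ⟨j, -, hj⟩ := h2
  rw [cosFactor, Complex.ofReal_eq_zero] at hj
  refine (Real.cos_pos_of_mem_Ioo ⟨?_, ?_⟩).ne' hj
  · refine lt_of_lt_of_le (by linarith [Real.pi_pos]) (show (0 : ℝ) ≤ _ from ?_)
    exact mul_nonneg (by positivity) (hx j).1.le
  · change Real.pi * k j * (1 / (2 * ((k j : ℝ) + 1))) < Real.pi / 2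
    rw [mul_one_div, div_lt_div_iff₀ (by positivity) (by norm_num)]
    nlinarith [Real.pi_pos]

/-- The normalized cosine mode. -/
noncomputable def cosUnit (k : Fin d → ℕ) : L2 (unitCell d) := ((‖cosLp k‖⁻¹ : ℝ) : ℂ) • cosLp k

/-- The sine mode, divided by the norm of the cosine mode. -/
noncomputable def sinUnit (i : Fin d) (k : Fin d → ℕ) : L2 (unitCell d) :=
  ((‖cosLp k‖⁻¹ : ℝ) : ℂ) • sinLp i k

theorem inner_smul_smul_real {X : Type*} [NormedAddCommGroup X] [InnerProductSpace ℂ X]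
    (a b : ℝ) (x y : X) : inner ℂ ((a : ℂ) • x) ((b : ℂ) • y) = (a : ℂ) * b * inner ℂ x y := by
  rw [inner_smul_left, inner_smul_right, Complex.conj_ofReal]
  ring

theorem orthonormal_cosUnit : Orthonormal ℂ (cosUnit (d := d)) := by
  refine ⟨fun k => ?_, fun k l h => ?_⟩
  · rw [cosUnit, norm_smul, Complex.norm_real, norm_inv, norm_norm,
      inv_mul_cancel₀ (norm_ne_zero_iff.2 (cosLp_ne_zero k))]
  · change inner ℂ (cosUnit k) (cosUnit l) = 0
    rw [cosUnit, cosUnit, inner_smul_smul_real, inner_cosLp_of_ne h, mul_zero]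

theorem mul_inner_cosUnit {p : Jet (unitCell d)} (hp : p ∈ H1 (unitCell d)) (i : Fin d)
    (k : Fin d → ℕ) :
    ((Real.pi * k i : ℝ) : ℂ) * inner ℂ (cosUnit k) p.1 = - inner ℂ (sinUnit i k) (p.2 i) := by
  rw [cosUnit, sinUnit, inner_smul_left, inner_smul_left]
  linear_combination conj ((‖cosLp k‖⁻¹ : ℝ) : ℂ) * mul_inner_cosLp hp i k

theorem orthonormal_sinUnit (i : Fin d) :
    Orthonormal ℂ fun k : {k : Fin d → ℕ // k i ≠ 0} => sinUnit i k.1 := by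
  have key : ∀ k l : {k : Fin d → ℕ // k i ≠ 0},
      (l.1 i : ℂ) * inner ℂ (sinUnit i k.1) (sinUnit i l.1) =
        k.1 i * inner ℂ (cosUnit k.1) (cosUnit l.1) := fun k l => by
    rw [cosUnit, cosUnit, sinUnit, sinUnit, inner_smul_smul_real, inner_smul_smul_real]
    linear_combination
      -((‖cosLp k.1‖⁻¹ : ℝ) : ℂ) * ((‖cosLp l.1‖⁻¹ : ℝ) : ℂ) * mul_inner_cosLp_cosLp i k.1 l.1
  have hne : ∀ k : {k : Fin d → ℕ // k i ≠ 0}, (k.1 i : ℂ) ≠ 0 := fun k =>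
    Nat.cast_ne_zero.2 k.2
  classical
  rw [orthonormal_iff_ite]
  intro k l
  refine mul_left_cancel₀ (hne l) ?_
  rw [key, orthonormal_iff_ite.1 orthonormal_cosUnit k.1 l.1]
  by_cases h : k = l
  · simp [h]
  · simp [h, Subtype.coe_ne_coe.2 h]

/-- Bessel's inequality for the sine coefficients of a weak derivative. -/
theorem sum_mul_norm_inner_cosUnit_le {p : Jet (unitCell d)} (hp : p ∈ H1 (unitCell d))
    (i : Fin d) (A : Finset (Fin d → ℕ)) :
    ∑ k ∈ A, (Real.pi * k i) ^ 2 * ‖inner ℂ (cosUnit k) p.1‖ ^ 2 ≤ ‖p.2 i‖ ^ 2 := by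
  classical
  have h1 : ∀ k : Fin d → ℕ, (Real.pi * k i) ^ 2 * ‖inner ℂ (cosUnit k) p.1‖ ^ 2 =
      if k i ≠ 0 then ‖inner ℂ (sinUnit i k) (p.2 i)‖ ^ 2 else 0 := fun k => by
    split_ifs with h
    · rw [← norm_neg (inner ℂ (sinUnit i k) (p.2 i)), ← mul_inner_cosUnit hp, norm_mul,
        mul_pow _ ‖inner ℂ (cosUnit k) p.1‖, Complex.norm_real, Real.norm_eq_abs, sq_abs]
    · simp [not_not.1 h]
  have h2 : ∑ k ∈ A.subtype fun k => k i ≠ 0, ‖inner ℂ (sinUnit i k.1) (p.2 i)‖ ^ 2 ≤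
      ‖p.2 i‖ ^ 2 := (orthonormal_sinUnit i).sum_inner_products_le (p.2 i)
  rw [Finset.sum_congr rfl fun k _ => h1 k, ← Finset.sum_filter]
  refine (le_of_eq ?_).trans h2
  exact (Finset.sum_subtype_eq_sum_filter (s := A) (p := fun k => k i ≠ 0)
    fun k => ‖inner ℂ (sinUnit i k) (p.2 i)‖ ^ 2).symm

/-- The Hilbert basis of `L²(Y)` of normalized cosine modes. -/
noncomputable def cosBasis (d : ℕ) : HilbertBasis (Fin d → ℕ) ℂ (L2 (unitCell d)) :=
  HilbertBasis.mkOfOrthogonalEqBot orthonormal_cosUnit <| by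
    rw [Submodule.eq_bot_iff]
    intro u hu
    refine eq_zero_of_forall_integral_mul_cosMode_eq_zero u fun k => ?_
    have h := (Submodule.mem_orthogonal _ _).1 hu _ (Submodule.subset_span ⟨k, rfl⟩)
    rw [cosUnit, inner_smul_left, inner_cosLp] at h
    refine (mul_eq_zero.1 h).resolve_left ?_
    rw [Complex.conj_ofReal]
    refine Complex.ofReal_ne_zero.2 ?_
    exact inv_ne_zero (norm_ne_zero_iff.2 (cosLp_ne_zero k))

theorem coe_cosBasis (d : ℕ) : ⇑(cosBasis d) = cosUnit :=
  HilbertBasis.coe_mkOfOrthogonalEqBot _ _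

theorem HilbertBasis.hasSum_norm_inner_sq {ι X : Type*} [NormedAddCommGroup X]
    [InnerProductSpace ℂ X] (b : HilbertBasis ι ℂ X) (u : X) :
    HasSum (fun k => ‖inner ℂ (b k) u‖ ^ 2) (‖u‖ ^ 2) := by
  have h := b.hasSum_inner_mul_inner u u
  rw [inner_self_eq_norm_sq_to_K] at h
  have h2 : (fun k => inner ℂ u (b k) * inner ℂ (b k) u) =
      fun k => ((‖inner ℂ (b k) u‖ ^ 2 : ℝ) : ℂ) := by
    ext k
    rw [← inner_conj_symm u (b k), ← Complex.normSq_eq_conj_mul_self, Complex.normSq_eq_norm_sq]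
  rw [h2] at h
  rw [← RCLike.ofReal_pow] at h
  exact Complex.hasSum_ofReal.1 h

/-- Truncation of the cosine series to the modes with all frequencies less than `N`. -/
noncomputable def cosTruncation (d N : ℕ) : L2 (unitCell d) →L[ℂ] L2 (unitCell d) :=
  ∑ k ∈ Fintype.piFinset fun _ : Fin d => Finset.range N,
    (innerSL ℂ (cosUnit k)).smulRight (cosUnit k)

theorem cosTruncation_apply (N : ℕ) (u : L2 (unitCell d)) : cosTruncation d N u =
    ∑ k ∈ Fintype.piFinset fun _ : Fin d => Finset.range N,
      (inner ℂ (cosUnit k) u : ℂ) • cosUnit k := by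
  simp [cosTruncation, sum_apply]

theorem inner_cosUnit_sub_cosTruncation (N : ℕ) (u : L2 (unitCell d)) (k : Fin d → ℕ) :
    inner ℂ (cosUnit k) (u - cosTruncation d N u) =
      if ∀ j, k j < N then 0 else inner ℂ (cosUnit k) u := by
  classical
  have h := orthonormal_iff_ite.1 (orthonormal_cosUnit (d := d))
  rw [inner_sub_right, cosTruncation_apply, inner_sum]
  simp only [inner_smul_right, h, mul_ite, mul_one, mul_zero, Finset.sum_ite_eq,
    Fintype.mem_piFinset, Finset.mem_range]
  split_ifs <;> simp

/-- The remainder of the cosine series of an `H¹` function is controlled by its gradient. With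
`N = 1` this is the Poincaré-Wirtinger inequality; as `N → ∞` it gives Rellich's theorem. -/
theorem norm_sub_cosTruncation_le {p : Jet (unitCell d)} (hp : p ∈ H1 (unitCell d)) {N : ℕ}
    (hN : 0 < N) :
    ‖p.1 - cosTruncation d N p.1‖ ≤ (Real.pi * N)⁻¹ * ‖WithLp.toLp 2 p.2‖ := by
  have hN' : (0 : ℝ) < N := Nat.cast_pos.2 hN
  have hπN : 0 < Real.pi * N := mul_pos Real.pi_pos hN'
  refine (sq_le_sq₀ (norm_nonneg _) (by positivity)).1 ?_
  have hsum := (cosBasis d).hasSum_norm_inner_sq (p.1 - cosTruncation d N p.1)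
  rw [coe_cosBasis] at hsum
  refine hasSum_le_of_sum_le hsum fun A => ?_
  have hk : ∀ k : Fin d → ℕ, ‖inner ℂ (cosUnit k) (p.1 - cosTruncation d N p.1)‖ ^ 2 ≤
      ((Real.pi * N)⁻¹) ^ 2 * ∑ i, (Real.pi * k i) ^ 2 * ‖inner ℂ (cosUnit k) p.1‖ ^ 2 := by
    intro k
    rw [inner_cosUnit_sub_cosTruncation]
    split_ifs with h
    · rw [norm_zero, zero_pow two_ne_zero]
      positivity
    · push Not at h
      obtain ⟨j, hj⟩ := h
      have hj' : Real.pi * N ≤ Real.pi * k j :=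
        mul_le_mul_of_nonneg_left (Nat.cast_le.2 hj) Real.pi_pos.le
      have h1 := Finset.single_le_sum (f := fun i =>
        (Real.pi * k i) ^ 2 * ‖inner ℂ (cosUnit k) p.1‖ ^ 2) (fun i _ => by positivity)
        (Finset.mem_univ j)
      have h2 : (Real.pi * N) ^ 2 * ‖inner ℂ (cosUnit k) p.1‖ ^ 2 ≤
          ∑ i, (Real.pi * k i) ^ 2 * ‖inner ℂ (cosUnit k) p.1‖ ^ 2 := by
        refine le_trans ?_ h1
        gcongr
      rw [inv_pow, inv_mul_eq_div, le_div_iff₀ (by positivity), mul_comm]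
      exact h2
  calc ∑ k ∈ A, ‖inner ℂ (cosUnit k) (p.1 - cosTruncation d N p.1)‖ ^ 2
      ≤ ∑ k ∈ A, ((Real.pi * N)⁻¹) ^ 2 *
          ∑ i, (Real.pi * k i) ^ 2 * ‖inner ℂ (cosUnit k) p.1‖ ^ 2 :=
        Finset.sum_le_sum fun k _ => hk k
    _ = ((Real.pi * N)⁻¹) ^ 2 *
          ∑ i, ∑ k ∈ A, (Real.pi * k i) ^ 2 * ‖inner ℂ (cosUnit k) p.1‖ ^ 2 := by
        rw [← Finset.mul_sum, Finset.sum_comm]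
    _ ≤ ((Real.pi * N)⁻¹) ^ 2 * ∑ i, ‖p.2 i‖ ^ 2 := by
        gcongr with i
        exact sum_mul_norm_inner_cosUnit_le hp i A
    _ = ((Real.pi * N)⁻¹ * ‖WithLp.toLp 2 p.2‖) ^ 2 := by
        rw [mul_pow, PiLp.norm_sq_eq_of_L2]

theorem isCompactOperator_smulRight {X Z : Type*} [NormedAddCommGroup X] [NormedSpace ℂ X]
    [NormedAddCommGroup Z] [NormedSpace ℂ Z] (L : X →L[ℂ] ℂ) (z : Z) :
    IsCompactOperator (L.smulRight z) :=
  ((isCompactOperator_id (E := ℂ)).comp_clm L).clm_comp (ContinuousLinearMap.toSpanSingleton ℂ z)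

theorem isCompactOperator_cosTruncation (d N : ℕ) : IsCompactOperator (cosTruncation d N) :=
  Finset.sum_induction _ (fun T : L2 (unitCell d) →L[ℂ] L2 (unitCell d) => IsCompactOperator T)
    (fun _ _ hS hT => hS.add hT) isCompactOperator_zero
    fun _ _ => isCompactOperator_smulRight _ _

end Modes

/-! ### Eigenbases of compact symmetric operators -/

section Eigenbasis

open Module.End

variable {K : Type*} [NormedAddCommGroup K] [InnerProductSpace ℂ K]

theorem Orthonormal.one_le_dist {ι : Type*} {v : ι → K} (hv : Orthonormal ℂ v) {i j : ι}
    (h : i ≠ j) : 1 ≤ dist (v i) (v j) := by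
  have h1 := norm_sub_sq (𝕜 := ℂ) (v i) (v j)
  rw [hv.2 h, hv.1, hv.1] at h1
  rw [dist_eq_norm]
  simp only [map_zero] at h1
  nlinarith [norm_nonneg (v i - v j)]

/-- Balls of radius `1/2` around the members of an orthonormal system are disjoint. -/
theorem Orthonormal.countable_index [TopologicalSpace.SeparableSpace K] {ι : Type*} {v : ι → K}
    (hv : Orthonormal ℂ v) : Countable ι := by
  refine Pairwise.countable_of_isOpen_disjoint (s := fun i => Metric.ball (v i) (1 / 2))
    (fun i j h => Metric.ball_disjoint_ball ?_) (fun i => Metric.isOpen_ball)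
    fun i => ⟨v i, Metric.mem_ball_self (by norm_num)⟩
  exact (by norm_num : (1 / 2 : ℝ) + 1 / 2 ≤ 1).trans (hv.one_le_dist h)

/-- A compact symmetric operator on a separable infinite dimensional Hilbert space has an
orthonormal basis of eigenvectors. -/
theorem exists_hilbertBasis_eigenvectors [CompleteSpace K] [TopologicalSpace.SeparableSpace K]
    (hK : ¬ FiniteDimensional ℂ K) {G : K →L[ℂ] K} (hc : IsCompactOperator G)
    (hs : G.IsSymmetric) :
    ∃ (b : HilbertBasis ℕ ℂ K) (μ : ℕ → ℝ), ∀ n, G (b n) = (μ n : ℂ) • b n := by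
  let F : ℂ → Submodule ℂ K := fun μ => eigenspace (G : Module.End ℂ K) μ
  have hFc : ∀ μ, CompleteSpace (F μ) := fun μ => by
    have hcl : IsClosed (F μ : Set K) := by
      have : (F μ : Set K) = {x | G x = μ • x} := by
        ext x
        exact mem_eigenspace_iff
      rw [this]
      exact isClosed_eq G.continuous (continuous_const_smul μ)
    exact hcl.completeSpace_coe
  -- Bases of the eigenspaces are put together.
  choose w b hb using fun μ => exists_hilbertBasis ℂ (F μ)
  have hon : Orthonormal ℂ fun a : Σ μ, w μ => ((b a.1 a.2 : F a.1) : K) :=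
    hs.orthogonalFamily_eigenspaces.orthonormal_sigma_orthonormal fun μ => (b μ).orthonormal
  have hbot : (Submodule.span ℂ (Set.range fun a : Σ μ, w μ => ((b a.1 a.2 : F a.1) : K)))ᗮ
      = ⊥ := by
    rw [Submodule.eq_bot_iff]
    intro x hx
    have hx' := (Submodule.mem_orthogonal _ _).1 hx
    have hxF : ∀ μ, ∀ y : F μ, inner ℂ (y : K) x = 0 := by
      intro μ
      have hcl : IsClosed {y : F μ | inner ℂ (y : K) x = 0} :=
        isClosed_eq (by fun_prop) continuous_const
      have hsub : (Submodule.span ℂ (Set.range (b μ)) : Set (F μ)) ⊆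
          {y : F μ | inner ℂ (y : K) x = 0} := by
        intro y hy
        induction hy using Submodule.span_induction with
        | mem y hy =>
          obtain ⟨a, rfl⟩ := hy
          exact hx' _ (Submodule.subset_span ⟨⟨μ, a⟩, rfl⟩)
        | zero => simp
        | add y z _ _ hy hz =>
          change inner ℂ ((y : K) + (z : K)) x = 0
          rw [inner_add_left, show inner ℂ (y : K) x = 0 from hy,
            show inner ℂ (z : K) x = 0 from hz, add_zero]
        | smul c y _ hy =>
          change inner ℂ (c • (y : K)) x = 0
          rw [inner_smul_left, show inner ℂ (y : K) x = 0 from hy, mul_zero]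
      have hd : closure (Submodule.span ℂ (Set.range (b μ)) : Set (F μ)) = Set.univ := by
        exact (Submodule.dense_iff_topologicalClosure_eq_top.2 (b μ).dense_span).closure_eq
      intro y
      exact closure_minimal hsub hcl (hd ▸ Set.mem_univ y)
    have hmem : x ∈ (⨆ μ, eigenspace (G : Module.End ℂ K) μ)ᗮ := by
      rw [Submodule.mem_orthogonal]
      intro u hu
      refine Submodule.iSup_induction _ (motive := fun u => inner ℂ u x = 0) hu
        (fun μ y hy => hxF μ ⟨y, hy⟩) (inner_zero_left _) fun y z hy hz => ?_
      rw [inner_add_left, hy, hz, add_zero]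
    rw [ContinuousLinearMap.orthogonalComplement_iSup_eigenspaces_eq_bot hc hs] at hmem
    exact (Submodule.mem_bot ℂ).1 hmem
  have hcount : Countable (Σ μ, w μ) := hon.countable_index
  have hinf : Infinite (Σ μ, w μ) := by
    by_contra hfin
    rw [not_infinite_iff_finite] at hfin
    have := Fintype.ofFinite (Σ μ, w μ)
    let b' := (HilbertBasis.mkOfOrthogonalEqBot hon hbot).toOrthonormalBasis.toBasis
    exact hK b'.finiteDimensional_of_finite
  obtain ⟨e⟩ := nonempty_equiv_of_countable (α := ℕ) (β := Σ μ, w μ)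
  have hrange : Set.range ((fun a : Σ μ, w μ => ((b a.1 a.2 : F a.1) : K)) ∘ e) =
      Set.range fun a : Σ μ, w μ => ((b a.1 a.2 : F a.1) : K) := e.surjective.range_comp _
  refine ⟨HilbertBasis.mkOfOrthogonalEqBot (hon.comp e e.injective) (by rw [hrange, hbot]),
    fun n => (e n).1.re, fun n => ?_⟩
  rw [HilbertBasis.coe_mkOfOrthogonalEqBot]
  have hmem := (b (e n).1 (e n).2).2
  have hne : ((b (e n).1 (e n).2 : F (e n).1) : K) ≠ 0 := hon.ne_zero (e n)
  have hreal := hs.conj_eigenvalue_eq_self (hasEigenvalue_of_hasEigenvector ⟨hmem, hne⟩)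
  have hGx : G (b (e n).1 (e n).2 : F (e n).1) = (e n).1 • ((b (e n).1 (e n).2 : F (e n).1) : K) :=
    mem_eigenspace_iff.1 hmem
  have hre : (((e n).1.re : ℝ) : ℂ) = (e n).1 := Complex.conj_eq_iff_re.1 hreal
  simp only [Function.comp_apply]
  rw [hre]
  exact hGx

/-- If a compact operator acts on an orthonormal system by `δᵢ G bᵢ = bᵢ`, then only finitely
many of the `δᵢ` lie in a given bounded set: the images of the other `bᵢ` stay apart. -/
theorem finite_setOf_abs_le_of_isCompactOperator {G : K →L[ℂ] K} (hc : IsCompactOperator G)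
    {b : ℕ → K} (hb : Orthonormal ℂ b) {δ : ℕ → ℝ} (hδ : ∀ i, (δ i : ℂ) • G (b i) = b i) (r : ℝ) :
    {i | |δ i| ≤ r}.Finite := by
  by_contra hinf
  have hδ0 : ∀ i, δ i ≠ 0 := fun i h => hb.ne_zero i (by rw [← hδ i, h]; simp)
  have hG : ∀ i, G (b i) = ((δ i)⁻¹ : ℂ) • b i := fun i => by
    conv_rhs => rw [← hδ i]
    rw [smul_smul, inv_mul_cancel₀ (Complex.ofReal_ne_zero.2 (hδ0 i)), one_smul]
  let e := Set.Infinite.natEmbedding _ hinf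
  have hr : 0 < r := (abs_pos.2 (hδ0 (e 0))).trans_le (e 0).2
  obtain ⟨Q, hQ, hQ'⟩ := hc.image_closedBall_subset_compact 1
  obtain ⟨y, -, φ, hφ, hlim⟩ := hQ.tendsto_subseq (x := fun n => G (b (e n))) fun n =>
    hQ' ⟨b (e n), by simp [hb.1], rfl⟩
  have hcau := hlim.cauchySeq
  rw [Metric.cauchySeq_iff'] at hcau
  obtain ⟨N, hN⟩ := hcau r⁻¹ (by positivity)
  have hlt := hN (N + 1) (Nat.le_succ N)
  refine absurd hlt (not_lt.2 ?_)
  have hne : (e (φ (N + 1))).1 ≠ (e (φ N)).1 := fun h =>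
    (hφ (Nat.lt_succ_self N)).ne' (e.injective (Subtype.ext h))
  simp only [Function.comp_apply]
  set i : ℕ := (e (φ (N + 1))).1 with hi
  set j : ℕ := (e (φ N)).1 with hj
  have hri : r⁻¹ ≤ |(δ i)⁻¹| := by
    rw [abs_inv]
    exact inv_anti₀ (abs_pos.2 (hδ0 i)) (e (φ (N + 1))).2
  rw [dist_eq_norm, hG, hG]
  have h1 := norm_sub_sq (𝕜 := ℂ) (((δ i)⁻¹ : ℂ) • b i) (((δ j)⁻¹ : ℂ) • b j)
  rw [inner_smul_left, inner_smul_right, hb.2 hne, norm_smul, norm_smul, hb.1, hb.1] at h1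
  have h2 : ‖((δ i)⁻¹ : ℂ)‖ = |(δ i)⁻¹| := by
    rw [← Complex.ofReal_inv, Complex.norm_real, Real.norm_eq_abs]
  rw [h2] at h1
  simp only [mul_zero, map_zero, sub_zero, mul_one] at h1
  refine hri.trans ((sq_le_sq₀ (abs_nonneg _) (norm_nonneg _)).1 ?_)
  rw [h1]
  nlinarith [sq_nonneg ‖((δ j)⁻¹ : ℂ)‖]

/-- Consequently the `δᵢ` other than `ν` keep a positive distance from `ν`. -/
theorem exists_pos_le_abs_sub {G : K →L[ℂ] K} (hc : IsCompactOperator G)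
    {b : ℕ → K} (hb : Orthonormal ℂ b) {δ : ℕ → ℝ} (hδ : ∀ i, (δ i : ℂ) • G (b i) = b i) (ν : ℝ) :
    ∃ ε > 0, ∀ i, ν ≠ δ i → ε ≤ |ν - δ i| := by
  have hfin := finite_setOf_abs_le_of_isCompactOperator hc hb hδ (|ν| + 1)
  have hfar : ∀ i, ¬ |δ i| ≤ |ν| + 1 → 1 ≤ |ν - δ i| := fun i hi => by
    have := abs_sub_abs_le_abs_sub (δ i) ν
    rw [abs_sub_comm] at this
    linarith
  have hfin' : {i | |δ i| ≤ |ν| + 1 ∧ ν ≠ δ i}.Finite := hfin.subset fun i hi => hi.1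
  rcases Set.eq_empty_or_nonempty {i | |δ i| ≤ |ν| + 1 ∧ ν ≠ δ i} with he | hne
  · refine ⟨1, one_pos, fun i hi => hfar i fun h => ?_⟩
    exact (Set.eq_empty_iff_forall_notMem.1 he i) ⟨h, hi⟩
  · obtain ⟨i₀, hi₀, hmin⟩ := Set.exists_min_image _ (fun i => |ν - δ i|) hfin' hne
    refine ⟨min 1 |ν - δ i₀|, lt_min one_pos (abs_pos.2 (sub_ne_zero.2 hi₀.2)), fun i hi => ?_⟩
    by_cases h : |δ i| ≤ |ν| + 1
    · exact (min_le_right _ _).trans (hmin i ⟨h, hi⟩)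
    · exact (min_le_left _ _).trans (hfar i h)

end Eigenbasis

/-! ### The secular equation -/

section Secular

variable {K : Type*} [NormedAddCommGroup K] [InnerProductSpace ℂ K]
  {G : K →L[ℂ] K} {b : HilbertBasis ℕ ℂ K} {δ : ℕ → ℝ}

theorem mul_inner_eigenvector (hs : G.IsSymmetric) (hδ : ∀ i, (δ i : ℂ) • G (b i) = b i)
    (i : ℕ) (g : K) : (δ i : ℂ) * inner ℂ (b i) (G g) = inner ℂ (b i) g := by
  have h : inner ℂ (G (b i)) g = inner ℂ (b i) (G g) := hs (b i) g
  conv_rhs => rw [← hδ i]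
  rw [inner_smul_left, Complex.conj_ofReal, h]

theorem HilbertBasis.ext_inner {x y : K} (h : ∀ i, inner ℂ (b i) x = inner ℂ (b i) y) : x = y := by
  refine b.repr.injective (lp.ext ?_)
  ext i
  rw [b.repr_apply_apply, b.repr_apply_apply, h]

/-- If `(ν - δᵢ) cᵢ = ν m β̄ᵢ` for the coefficients `cᵢ` of `u` and `βᵢ = (o, bᵢ)`, then the
scalar product `(o, u)` is `m` times the secular series. -/
theorem hasSum_secular {ν : ℝ} {m : ℂ} {o u : K}
    (hpole : ∀ i, inner ℂ o (b i) ≠ 0 → ν ≠ δ i)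
    (hc : ∀ i, inner ℂ o (b i) ≠ 0 →
      ((ν : ℂ) - δ i) * inner ℂ (b i) u = ν * m * inner ℂ (b i) o) :
    HasSum (fun i : {i : ℕ // inner ℂ o (b i) ≠ 0} =>
      (ν : ℂ) * m * ((‖inner ℂ o (b i)‖ ^ 2 / (ν - δ i) : ℝ) : ℂ)) (inner ℂ o u) := by
  have h := b.hasSum_inner_mul_inner o u
  have hsupp : Function.support (fun i => inner ℂ o (b i) * inner ℂ (b i) u) ⊆
      {i | inner ℂ o (b i) ≠ 0} := fun i hi h0 => hi (by simp [h0])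
  have h' := (hasSum_subtype_iff_of_support_subset hsupp).2 h
  refine h'.congr_fun ?_
  rintro ⟨i, hi⟩
  have hne : ((ν : ℂ) - δ i) ≠ 0 := by
    rw [← Complex.ofReal_sub]
    exact Complex.ofReal_ne_zero.2 (sub_ne_zero.2 (hpole i hi))
  have hn : ((‖inner ℂ o (b i)‖ ^ 2 : ℝ) : ℂ) = inner ℂ (b i) o * inner ℂ o (b i) := by
    rw [← inner_conj_symm (b i) o, ← Complex.normSq_eq_conj_mul_self, Complex.normSq_eq_norm_sq]
  simp only [Function.comp_apply]
  rw [Complex.ofReal_div, hn, Complex.ofReal_sub, ← mul_div_assoc, div_eq_iff hne]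
  linear_combination (-inner ℂ o (b i)) * hc i hi

/-- The eigenvalue problem for the rank one perturbation `g ↦ G g - (o, G g) o` of `G`: an
eigenvector `g` with eigenvalue `1/ν` is either an eigenvector of `G` itself, with `(o, g) = 0`,
or `ν` is a root of the secular equation. -/
theorem exists_rankOne_eigenvector_iff [CompleteSpace K] (hs : G.IsSymmetric)
    (hcomp : IsCompactOperator G) (hδ : ∀ i, (δ i : ℂ) • G (b i) = b i) (o : K) {ν : ℝ}
    (hν : 0 < ν) :
    (∃ g : K, g ≠ 0 ∧ G g - (inner ℂ o (G g) : ℂ) • o = ((ν⁻¹ : ℝ) : ℂ) • g) ↔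
      (∃ x : K, x ≠ 0 ∧ (ν : ℂ) • G x = x ∧ inner ℂ o x = 0) ∨
      ((∀ i, inner ℂ o (b i) ≠ 0 → ν ≠ δ i) ∧
        ν * ∑' i : {i : ℕ // inner ℂ o (b i) ≠ 0}, ‖inner ℂ o (b i)‖ ^ 2 / (ν - δ i) - 1 = 0) := by
  have hνC : (ν : ℂ) ≠ 0 := Complex.ofReal_ne_zero.2 hν.ne'
  constructor
  · rintro ⟨g, hg, he⟩
    set u := G g with hu
    set m : ℂ := inner ℂ o u with hm
    have hgu : g = (ν : ℂ) • (u - m • o) := by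
      rw [he, smul_smul, Complex.ofReal_inv, mul_inv_cancel₀ hνC, one_smul]
    by_cases hm0 : m = 0
    · left
      have hgu' : g = (ν : ℂ) • u := by rw [hgu, hm0, zero_smul, sub_zero]
      refine ⟨u, fun h => hg (by rw [hgu', h, smul_zero]), ?_, hm0⟩
      rw [← map_smul, ← hgu']
    · right
      have hco : ∀ i, ((ν : ℂ) - δ i) * inner ℂ (b i) u = ν * m * inner ℂ (b i) o := fun i => by
        have h1 := mul_inner_eigenvector hs hδ i g
        rw [← hu] at h1
        have h2 : inner ℂ (b i) g = ν * (inner ℂ (b i) u - m * inner ℂ (b i) o) := by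
          conv_lhs => rw [hgu]
          rw [inner_smul_right, inner_sub_right, inner_smul_right]
        linear_combination -h1 - h2
      have hpole : ∀ i, inner ℂ o (b i) ≠ 0 → ν ≠ δ i := by
        rintro i hi rfl
        have h := hco i
        rw [sub_self, zero_mul] at h
        have h' : inner ℂ (b i) o ≠ 0 := fun h0 => hi (by
          rw [← inner_conj_symm, h0, map_zero])
        exact mul_ne_zero (mul_ne_zero hνC hm0) h' h.symm
      refine ⟨hpole, ?_⟩
      have hsum := (hasSum_secular hpole fun i _ => hco i).mul_left ((ν * m : ℂ)⁻¹)
      rw [← hm, mul_inv, mul_assoc, inv_mul_cancel₀ hm0, mul_one] at hsum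
      have hsum' : HasSum (fun i : {i : ℕ // inner ℂ o (b i) ≠ 0} =>
          ‖inner ℂ o (b i)‖ ^ 2 / (ν - δ i)) ν⁻¹ := by
        refine Complex.hasSum_ofReal.1 ?_
        rw [Complex.ofReal_inv]
        refine hsum.congr_fun ?_
        intro i
        field_simp
      rw [hsum'.tsum_eq, mul_inv_cancel₀ hν.ne', sub_self]
  · rintro (⟨x, hx, hGx, hox⟩ | ⟨hpole, hS⟩)
    · have hGx' : G x = ((ν⁻¹ : ℝ) : ℂ) • x := by
        conv_rhs => rw [← hGx]
        rw [smul_smul, Complex.ofReal_inv, inv_mul_cancel₀ hνC, one_smul]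
      refine ⟨x, hx, ?_⟩
      rw [hGx', inner_smul_right, hox, mul_zero, zero_smul, sub_zero]
    · obtain ⟨ε, hε, hgap⟩ := exists_pos_le_abs_sub hcomp b.orthonormal hδ ν
      have hδ0 : ∀ i, (δ i : ℂ) ≠ 0 := fun i h => b.orthonormal.ne_zero i (by
        rw [← hδ i, h, zero_smul])
      classical
      -- The coefficients of the solution `u` of `u = ν G (u - o)`.
      let c : ℕ → ℂ := fun i =>
        if inner ℂ o (b i) = 0 then 0 else ν * inner ℂ (b i) o / (ν - δ i)
      have hne : ∀ i, inner ℂ o (b i) ≠ 0 → ((ν : ℂ) - δ i) ≠ 0 := fun i hi => by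
        rw [← Complex.ofReal_sub]
        exact Complex.ofReal_ne_zero.2 (sub_ne_zero.2 (hpole i hi))
      have hco : ∀ i, ((ν : ℂ) - δ i) * c i = ν * inner ℂ (b i) o := fun i => by
        by_cases hi : inner ℂ o (b i) = 0
        · have : inner ℂ (b i) o = 0 := by rw [← inner_conj_symm, hi, map_zero]
          simp [c, hi, this]
        · simp only [c, hi, if_false]
          rw [mul_div_cancel₀ _ (hne i hi)]
      have hcbd : ∀ i, ‖c i‖ ^ 2 ≤ (ν / ε) ^ 2 * ‖inner ℂ (b i) o‖ ^ 2 := fun i => by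
        by_cases hi : inner ℂ o (b i) = 0
        · rw [show c i = 0 from if_pos hi, norm_zero, zero_pow two_ne_zero]
          positivity
        · simp only [c, hi, if_false]
          rw [← mul_pow, norm_div, norm_mul, ← Complex.ofReal_sub, Complex.norm_real,
            Complex.norm_real, Real.norm_eq_abs, Real.norm_eq_abs, abs_of_pos hν,
            div_mul_eq_mul_div]
          gcongr
          exact hgap i (hpole i hi)
      have hmem : Memℓp c 2 := by
        refine memℓp_gen ?_
        simp only [ENNReal.toReal_ofNat, Real.rpow_ofNat]
        exact Summable.of_nonneg_of_le (fun i => by positivity) hcbd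
          ((b.hasSum_norm_inner_sq o).summable.mul_left _)
      let u : K := b.repr.symm ⟨c, hmem⟩
      have hu : ∀ i, inner ℂ (b i) u = c i := fun i => by
        rw [← b.repr_apply_apply, LinearIsometryEquiv.apply_symm_apply]
      have hsecular := hasSum_secular (u := u) (m := 1) hpole fun i _ => by
        rw [hu, hco, mul_one]
      have hou : inner ℂ o u = 1 := by
        rw [← hsecular.tsum_eq, tsum_mul_left, ← Complex.ofReal_tsum, mul_one,
          ← Complex.ofReal_mul, sub_eq_zero.1 hS, Complex.ofReal_one]
      have hG : G ((ν : ℂ) • (u - o)) = u := b.ext_inner fun i => by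
        refine mul_left_cancel₀ (hδ0 i) ?_
        rw [mul_inner_eigenvector hs hδ, inner_smul_right, inner_sub_right, hu]
        linear_combination hco i
      refine ⟨(ν : ℂ) • (u - o), fun h => ?_, ?_⟩
      · rw [h, map_zero] at hG
        rw [← hG, inner_zero_right] at hou
        exact zero_ne_one hou
      · rw [hG, hou, one_smul, smul_smul, Complex.ofReal_inv, inv_mul_cancel₀ hνC, one_smul]

end Secular

/-! ### The Neumann and Dirichlet problems -/

section Problems

variable {d : ℕ}

theorem volume_unitCell (d : ℕ) : volume (unitCell d) = 1 := by
  have h := (PiLp.volume_preserving_toLp (Fin d)).measure_preimage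
    (measurableSet_unitCell d).nullMeasurableSet
  have hpre : (WithLp.toLp 2) ⁻¹' (unitCell d) =
      Set.pi Set.univ fun _ : Fin d => Set.Ioo (0 : ℝ) 1 := by
    ext x
    simp [unitCell]
  rw [← h, hpre, Real.volume_pi_Ioo]
  simp

theorem cosMode_zero (x : EuclideanSpace ℝ (Fin d)) : cosMode (0 : Fin d → ℕ) x = 1 := by
  simp [cosMode, tensor, cosFactor]

theorem inner_cosLp_zero (u : L2 (unitCell d)) :
    inner ℂ (cosLp (0 : Fin d → ℕ)) u = ∫ x in unitCell d, u x := by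
  rw [inner_cosLp]
  simp only [cosMode_zero, mul_one]

theorem coeFn_cosLp_zero :
    cosLp (0 : Fin d → ℕ) =ᵐ[volume.restrict (unitCell d)] fun _ => (1 : ℂ) := by
  filter_upwards [(memLp_cosMode (0 : Fin d → ℕ)).coeFn_toLp] with x hx
  rw [cosLp, hx, cosMode_zero]

theorem inner_cosLp_zero_self :
    inner ℂ (cosLp (0 : Fin d → ℕ)) (cosLp (0 : Fin d → ℕ)) = (1 : ℂ) := by
  rw [inner_cosLp_zero, integral_congr_ae coeFn_cosLp_zero]
  simp [Measure.real, volume_unitCell]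

theorem mem_L20_iff (u : L2 (unitCell d)) :
    u ∈ L20 d ↔ inner ℂ (cosLp (0 : Fin d → ℕ)) u = 0 := by
  rw [inner_cosLp_zero]
  rfl

theorem isClosed_L20 (d : ℕ) : IsClosed (L20 d : Set (L2 (unitCell d))) := by
  have : (L20 d : Set (L2 (unitCell d))) =
      {u | inner ℂ (cosLp (0 : Fin d → ℕ)) u = 0} := by
    ext u
    exact mem_L20_iff u
  rw [this]
  exact isClosed_eq (by fun_prop) continuous_const

theorem exists_submodule_meanZeroH1 (d : ℕ) : ∃ V : Submodule ℂ (Jet (unitCell d)),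
    (V : Set (Jet (unitCell d))) = meanZeroH1 d ∧ IsClosed (V : Set (Jet (unitCell d))) := by
  obtain ⟨V, hV, hVc⟩ := exists_submodule_H1 (unitCell d)
  refine ⟨V ⊓ (L20 d).comap (LinearMap.fst ℂ _ _), ?_, ?_⟩
  · ext p
    exact and_congr (Set.ext_iff.1 hV p) Iff.rfl
  · exact hVc.inter ((isClosed_L20 d).preimage continuous_fst)

/-- The Poincaré-Wirtinger inequality: the only mode with all frequencies less than `1` is the
constant. -/
theorem norm_fst_le_of_mem_meanZeroH1 {p : Jet (unitCell d)} (hp : p ∈ meanZeroH1 d) :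
    ‖p.1‖ ≤ (Real.pi * (1 : ℕ))⁻¹ * ‖WithLp.toLp 2 p.2‖ := by
  have h := norm_sub_cosTruncation_le hp.1 one_pos
  have h0 : cosTruncation d 1 p.1 = 0 := by
    rw [cosTruncation_apply]
    refine Finset.sum_eq_zero fun k hk => ?_
    have hk0 : k = 0 := by
      ext j
      simpa using Fintype.mem_piFinset.1 hk j
    rw [hk0, cosUnit, inner_smul_left, (mem_L20_iff p.1).1 hp.2, mul_zero, zero_smul]
  rwa [h0, sub_zero] at h

theorem exists_isNeumannSolution (f : L20 d) : ∃ w, IsNeumannSolution f w := by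
  obtain ⟨V, hV, hVc⟩ := exists_submodule_meanZeroH1 d
  have hmem : ∀ p, p ∈ V ↔ p ∈ meanZeroH1 d := fun p => Set.ext_iff.1 hV p
  obtain ⟨G, -, hG, -⟩ := exists_solution_operator V hVc _ fun p hp =>
    norm_fst_le_of_mem_meanZeroH1 ((hmem p).1 hp)
  obtain ⟨w, hw, -, hwv⟩ := hG f
  refine ⟨w, (hmem w).1 hw, fun v hv => ?_⟩
  rw [energyForm_eq_sum_inner, l2Form_eq_inner]
  exact hwv v ((hmem v).2 hv)

variable {D : Set (EuclideanSpace ℝ (Fin d))}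

theorem norm_fst_le_norm_snd_of_mem_H10 (hd : 1 ≤ d) (hDY : D ⊆ unitCell d) {q : Jet D}
    (hq : q ∈ H10 D) : ‖q.1‖ ≤ 2 * ‖WithLp.toLp 2 q.2‖ := by
  refine (norm_fst_le_of_mem_H10 hDY ⟨0, hd⟩ hq).trans ?_
  gcongr
  exact norm_apply_le_norm_toLp q.2 _

theorem norm_toLp_isometry {X Z ι : Type*} [NormedAddCommGroup X] [NormedAddCommGroup Z]
    [NormedSpace ℂ X] [NormedSpace ℂ Z] [Fintype ι] (J : X →ₗᵢ[ℂ] Z) (g : ι → X) :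
    ‖WithLp.toLp 2 fun i => J (g i)‖ = ‖WithLp.toLp 2 g‖ := by
  rw [PiLp.norm_eq_of_L2, PiLp.norm_eq_of_L2]
  simp only [J.norm_map]

/-- By truncation of the cosine series, the embedding of `H¹₀(D)` into `L²(D)` is a limit of
compact operators. -/
theorem exists_compact_approx_H10 (hD : MeasurableSet D) (J : L2 D →ₗᵢ[ℂ] L2 (unitCell d))
    (hJ : ∀ u, J u =ᵐ[volume.restrict (unitCell d)] D.indicator u) {ε : ℝ} (hε : 0 < ε) :
    ∃ P : L2 D →L[ℂ] L2 D, IsCompactOperator P ∧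
      ∀ q ∈ H10 D, ‖q.1 - P q.1‖ ≤ ε * ‖WithLp.toLp 2 q.2‖ := by
  obtain ⟨n, hn⟩ := exists_nat_gt (1 / ε)
  have hn0 : 0 < n := by
    have : (0 : ℝ) < n := lt_trans (by positivity) hn
    exact_mod_cast this
  let J' : L2 D →L[ℂ] L2 (unitCell d) := J.toContinuousLinearMap
  have hJJ : ∀ u, J'.adjoint (J' u) = u := fun u => by
    refine ext_inner_left ℂ fun v => ?_
    rw [ContinuousLinearMap.adjoint_inner_right]
    exact J.inner_map_map v u
  have hJn : ∀ f, ‖J'.adjoint f‖ ≤ ‖f‖ := fun f => by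
    refine (J'.adjoint.le_opNorm f).trans ?_
    rw [LinearIsometryEquiv.norm_map]
    exact mul_le_of_le_one_left (norm_nonneg _) J.norm_toContinuousLinearMap_le
  refine ⟨J'.adjoint ∘L cosTruncation d n ∘L J', ?_, fun q hq => ?_⟩
  · exact ((isCompactOperator_cosTruncation d n).comp_clm J').clm_comp J'.adjoint
  · have h := norm_sub_cosTruncation_le (mapJet_mem_H1 hD J' hJ hq) hn0
    have e : q.1 - (J'.adjoint ∘L cosTruncation d n ∘L J') q.1 =
        J'.adjoint (J' q.1 - cosTruncation d n (J' q.1)) := by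
      rw [map_sub, hJJ]
      rfl
    rw [e]
    refine (hJn _).trans (h.trans ?_)
    have e2 : ‖WithLp.toLp 2 (mapJet J' q).2‖ = ‖WithLp.toLp 2 q.2‖ := norm_toLp_isometry J q.2
    rw [e2]
    refine mul_le_mul_of_nonneg_right ?_ (norm_nonneg _)
    have hn' : (0 : ℝ) < n := Nat.cast_pos.2 hn0
    rw [inv_le_comm₀ (by positivity) hε]
    rw [one_div] at hn
    nlinarith [Real.pi_gt_three]

/-- The inverse Dirichlet Laplacian on `D`: a compact symmetric operator on `L²(D)`. -/
theorem exists_dirichletResolvent (hd : 1 ≤ d) (hDo : IsOpen D) (hDY : D ⊆ unitCell d) :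
    ∃ G : L2 D →L[ℂ] L2 D, IsCompactOperator G ∧ G.IsSymmetric ∧
      ∀ f, ∃ p ∈ H10 D, p.1 = G f ∧ ∀ v ∈ H10 D, energyForm p v = l2Form f v.1 := by
  obtain ⟨V, hV, hVc⟩ := exists_submodule_H10 D
  have hmem : ∀ p, p ∈ V ↔ p ∈ H10 D := fun p => Set.ext_iff.1 hV p
  obtain ⟨G, hs, hG, hc⟩ := exists_solution_operator V hVc _ fun p hp =>
    norm_fst_le_norm_snd_of_mem_H10 hd hDY ((hmem p).1 hp)
  refine ⟨G, hc fun ε hε => ?_, hs, fun f => ?_⟩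
  · obtain ⟨P, hP, hPb⟩ := exists_compact_approx_H10 hDo.measurableSet
      (extendZero hDo.measurableSet hDY) (coeFn_extendZero hDo.measurableSet hDY) hε
    exact ⟨P, hP, fun p hp => hPb p ((hmem p).1 hp)⟩
  · obtain ⟨p, hp, hpf, hpv⟩ := hG f
    refine ⟨p, (hmem p).1 hp, hpf, fun v hv => ?_⟩
    rw [energyForm_eq_sum_inner, l2Form_eq_inner]
    exact hpv v ((hmem v).2 hv)

theorem energyForm_self_eq {U : Set (EuclideanSpace ℝ (Fin d))} (p : Jet U) :
    energyForm p p = ((‖WithLp.toLp 2 p.2‖ ^ 2 : ℝ) : ℂ) := by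
  rw [energyForm_eq_sum_inner, PiLp.norm_sq_eq_of_L2, Complex.ofReal_sum]
  refine Finset.sum_congr rfl fun i _ => ?_
  rw [inner_self_eq_norm_sq_to_K]
  simp

theorem energyForm_sub_left {U : Set (EuclideanSpace ℝ (Fin d))} (p q v : Jet U) :
    energyForm (p - q) v = energyForm p v - energyForm q v := by
  simp only [energyForm_eq_sum_inner, Prod.snd_sub, Pi.sub_apply, inner_sub_right,
    Finset.sum_sub_distrib]

theorem sub_mem_H10 {p q : Jet D} (hp : p ∈ H10 D) (hq : q ∈ H10 D) : p - q ∈ H10 D := by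
  obtain ⟨V, hV, -⟩ := exists_submodule_H10 D
  rw [← hV] at hp hq ⊢
  exact V.sub_mem hp hq

theorem smul_mem_H10 (c : ℂ) {p : Jet D} (hp : p ∈ H10 D) : c • p ∈ H10 D := by
  obtain ⟨V, hV, -⟩ := exists_submodule_H10 D
  rw [← hV] at hp ⊢
  exact V.smul_mem c hp

/-- The weak Dirichlet problem has at most one solution. -/
theorem fst_eq_of_energyForm_eq (hd : 1 ≤ d) (hDY : D ⊆ unitCell d) {p q : Jet D}
    (hp : p ∈ H10 D) (hq : q ∈ H10 D)
    (h : ∀ v ∈ H10 D, energyForm p v = energyForm q v) : p.1 = q.1 := by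
  have hpq := sub_mem_H10 hp hq
  have h0 : energyForm (p - q) (p - q) = 0 := by
    rw [energyForm_sub_left, h _ hpq, sub_self]
  rw [energyForm_self_eq, Complex.ofReal_eq_zero] at h0
  have hn := norm_fst_le_norm_snd_of_mem_H10 hd hDY hpq
  rw [pow_eq_zero_iff two_ne_zero] at h0
  rw [h0, mul_zero] at hn
  exact sub_eq_zero.1 (norm_le_zero_iff.1 hn)

end Problems

/-! ### Dirichlet eigenfunctions and the inverse Dirichlet Laplacian -/

section Resolvent

variable {d : ℕ} {D : Set (EuclideanSpace ℝ (Fin d))}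

/-- `G` is the inverse of the Dirichlet Laplacian on `D`: `p = G f` solves the weak problem
`⟨p, v⟩ = (f, v)` for all `v ∈ H¹₀(D)`. -/
def IsDirichletResolvent (D : Set (EuclideanSpace ℝ (Fin d))) (G : L2 D →L[ℂ] L2 D) : Prop :=
  ∀ f, ∃ p ∈ H10 D, p.1 = G f ∧ ∀ v ∈ H10 D, energyForm p v = l2Form f v.1

theorem energyForm_smul_left {U : Set (EuclideanSpace ℝ (Fin d))} (c : ℂ) (p v : Jet U) :
    energyForm (c • p) v = c * energyForm p v := by
  simp only [energyForm_eq_sum_inner, Prod.smul_snd, Pi.smul_apply, inner_smul_right,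
    Finset.mul_sum]

theorem IsTestFunction.conj {U : Set (EuclideanSpace ℝ (Fin d))}
    {φ : EuclideanSpace ℝ (Fin d) → ℂ} (hφ : IsTestFunction U φ) :
    IsTestFunction U fun x => conj (φ x) := by
  have hs : tsupport (fun x => conj (φ x)) ⊆ tsupport φ :=
    closure_mono fun x hx h => hx (by simp [h])
  exact ⟨Complex.conjCLE.contDiff.comp hφ.1,
    hφ.2.1.of_isClosed_subset (isClosed_tsupport _) hs, hs.trans hφ.2.2⟩

theorem eq_zero_of_forall_l2Form_eq_zero (hD : IsOpen D) {f : L2 D}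
    (h : ∀ v ∈ H10 D, l2Form f v.1 = 0) : f = 0 := by
  refine eq_zero_of_forall_integral_mul_eq_zero hD f fun φ hφ => ?_
  have hc := hφ.conj
  have hv := h ((hc.memLp D).toLp _, fun i => (hc.memLp_partialDeriv i D).toLp _)
    (subset_closure ⟨_, hc, (hc.memLp D).coeFn_toLp,
      fun i => (hc.memLp_partialDeriv i D).coeFn_toLp⟩)
  rw [l2Form] at hv
  rw [← hv]
  refine integral_congr_ae ?_
  filter_upwards [(hc.memLp D).coeFn_toLp] with x hx
  rw [hx, Complex.conj_conj]

variable {G : L2 D →L[ℂ] L2 D}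

/-- Positivity of `G`: `(f, G f)` is the energy of `G f`. -/
theorem IsDirichletResolvent.exists_inner_eq (hG : IsDirichletResolvent D G) (f : L2 D) :
    ∃ r : ℝ, 0 ≤ r ∧ inner ℂ f (G f) = (r : ℂ) := by
  obtain ⟨p, hp, hpf, hpv⟩ := hG f
  have h := hpv p hp
  rw [energyForm_self_eq, l2Form_eq_inner, hpf] at h
  refine ⟨_, sq_nonneg ‖WithLp.toLp 2 p.2‖, ?_⟩
  rw [← inner_conj_symm, ← h, Complex.conj_ofReal]

/-- Injectivity of `G`, from the density of the test functions in `L²(D)`. -/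
theorem IsDirichletResolvent.eq_zero (hG : IsDirichletResolvent D G) (hD : IsOpen D) {f : L2 D}
    (hf : G f = 0) : f = 0 := by
  obtain ⟨p, hp, hpf, hpv⟩ := hG f
  refine eq_zero_of_forall_l2Form_eq_zero hD fun v hv => ?_
  have h := hpv p hp
  rw [energyForm_self_eq, l2Form_eq_inner, hpf, hf, inner_zero_left, Complex.ofReal_eq_zero,
    pow_eq_zero_iff two_ne_zero, norm_eq_zero] at h
  have h2 : ∀ i, p.2 i = 0 := fun i => congrFun (congrArg WithLp.ofLp h) i
  rw [← hpv v hv, energyForm_eq_sum_inner]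
  exact Finset.sum_eq_zero fun i _ => by rw [h2, inner_zero_right]

/-- The Dirichlet eigenfunctions are the eigenvectors of the inverse Dirichlet Laplacian. -/
theorem isDirichletEigenfunction_iff (hd : 1 ≤ d) (hDY : D ⊆ unitCell d)
    (hG : IsDirichletResolvent D G) {δ : ℝ} {ψ : L2 D} :
    IsDirichletEigenfunction D δ ψ ↔ ψ ≠ 0 ∧ (δ : ℂ) • G ψ = ψ := by
  obtain ⟨q, hq, hqψ, hqv⟩ := hG ψ
  have hδq := smul_mem_H10 (δ : ℂ) hq
  have hδv : ∀ v ∈ H10 D, energyForm ((δ : ℂ) • q) v = δ * l2Form ψ v.1 := fun v hv => by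
    rw [energyForm_smul_left, hqv v hv]
  refine and_congr_right fun _ => ⟨?_, fun h => ⟨_, hδq, ?_, hδv⟩⟩
  · rintro ⟨p, hp, rfl, hpv⟩
    have h := fst_eq_of_energyForm_eq hd hDY hp hδq fun v hv => by rw [hpv v hv, hδv v hv]
    rw [Prod.smul_fst, hqψ] at h
    exact h.symm
  · rw [Prod.smul_fst, hqψ, h]

/-- The indicator functions of infinitely many disjoint open subsets of `D` are orthogonal. -/
theorem not_finiteDimensional_L2 (hd : 1 ≤ d) (hD : IsOpen D) (hne : D.Nonempty)
    (hDY : D ⊆ unitCell d) : ¬ FiniteDimensional ℂ (L2 D) := by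
  intro hfin
  have : Nonempty (Fin d) := ⟨⟨0, hd⟩⟩
  obtain ⟨x, hx⟩ := hne
  have hinf : D.Infinite := by
    have : (nhdsWithin x {x}ᶜ).NeBot := Module.punctured_nhds_neBot ℝ _ x
    exact infinite_of_mem_nhds x (hD.mem_nhds hx)
  have : Infinite D := hinf.to_subtype
  obtain ⟨V, hVi, hVo, hVd⟩ := exists_seq_infinite_isOpen_pairwise_disjoint D
  let W : ℕ → Set (EuclideanSpace ℝ (Fin d)) := fun n => Subtype.val '' V n
  have hWo : ∀ n, IsOpen (W n) := fun n => hD.isOpenMap_subtype_val _ (hVo n)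
  have hWD : ∀ n, W n ⊆ D := fun n => by
    rintro _ ⟨y, -, rfl⟩
    exact y.2
  have hWd : ∀ m n, m ≠ n → Disjoint (W m) (W n) := fun m n h =>
    (Set.disjoint_image_iff Subtype.val_injective).2 (hVd h)
  have hDfin : IsFiniteMeasure (volume.restrict D) := by
    have := isFiniteMeasure_unitCell d
    exact isFiniteMeasure_of_le _ (Measure.restrict_mono hDY le_rfl)
  let f : ℕ → L2 D := fun n =>
    indicatorConstLp 2 (hWo n).measurableSet (measure_ne_top (volume.restrict D) (W n)) (1 : ℂ)
  have hf0 : ∀ n, f n ≠ 0 := fun n h => by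
    have h1 := norm_indicatorConstLp (p := 2) (μ := volume.restrict D) (hs := (hWo n).measurableSet)
      (hμs := measure_ne_top (volume.restrict D) (W n)) (c := (1 : ℂ)) (by norm_num) (by norm_num)
    rw [show indicatorConstLp 2 (hWo n).measurableSet
      (measure_ne_top (volume.restrict D) (W n)) (1 : ℂ) = 0 from h, norm_zero, norm_one, one_mul]
      at h1
    have hpos : 0 < (volume.restrict D).real (W n) := by
      rw [Measure.real, Measure.restrict_apply (hWo n).measurableSet,
        Set.inter_eq_self_of_subset_left (hWD n)]
      refine ENNReal.toReal_pos ((hWo n).measure_pos volume ?_).ne' ?_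
      · exact ((hVi n).nonempty).image _
      · have h2 : volume (W n) ≤ volume (unitCell d) := measure_mono ((hWD n).trans hDY)
        rw [volume_unitCell] at h2
        exact (h2.trans_lt ENNReal.one_lt_top).ne
    exact (Real.rpow_pos_of_pos hpos _).ne h1
  have horth : Pairwise fun m n => inner ℂ (f m) (f n) = 0 := fun m n h => by
    change inner ℂ (f m) (f n) = 0
    rw [L2.inner_def]
    refine integral_eq_zero_of_ae ?_
    filter_upwards [indicatorConstLp_coeFn (p := 2) (μ := volume.restrict D)
      (hs := (hWo m).measurableSet) (hμs := measure_ne_top (volume.restrict D) (W m))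
      (c := (1 : ℂ)),
      indicatorConstLp_coeFn (p := 2) (μ := volume.restrict D)
      (hs := (hWo n).measurableSet) (hμs := measure_ne_top (volume.restrict D) (W n))
      (c := (1 : ℂ))]
      with y hm hn
    rw [hm, hn]
    by_cases hy : y ∈ W m
    · simp [Set.disjoint_left.1 (hWd m n h) hy]
    · simp [hy]
  have hli := linearIndependent_of_ne_zero_of_inner_eq_zero hf0 horth
  exact not_finite_iff_infinite.2 inferInstance hli.finite

theorem exists_isDirichletEigenbasis (hd : 1 ≤ d) (hD : IsOpen D) (hne : D.Nonempty)
    (hDY : D ⊆ unitCell d) :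
    ∃ (ψ : HilbertBasis ℕ ℂ (L2 D)) (δ : ℕ → ℝ), IsDirichletEigenbasis D ψ δ := by
  obtain ⟨G, hc, hs, hG⟩ := exists_dirichletResolvent hd hD hDY
  have : Fact ((2 : ENNReal) ≠ ⊤) := ⟨by norm_num⟩
  obtain ⟨b, μ, hb⟩ := exists_hilbertBasis_eigenvectors (not_finiteDimensional_L2 hd hD hne hDY)
    hc hs
  refine ⟨b, fun n => (μ n)⁻¹, fun n => ?_⟩
  refine (isDirichletEigenfunction_iff hd hDY hG).2 ⟨b.orthonormal.ne_zero n, ?_⟩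
  have hμ : μ n ≠ 0 := fun h => b.orthonormal.ne_zero n <|
    IsDirichletResolvent.eq_zero hG hD (by rw [hb, h, Complex.ofReal_zero, zero_smul])
  rw [hb, smul_smul, Complex.ofReal_inv, inv_mul_cancel₀ (Complex.ofReal_ne_zero.2 hμ), one_smul]

end Resolvent

/-! ### The limit operator and its spectrum -/

section LimitOperator

variable {d : ℕ} {D : Set (EuclideanSpace ℝ (Fin d))}
  (J : L2 D →ₗᵢ[ℂ] L2 (unitCell d))

/-- The element `ũ - (∫_D ũ) 1_Y` of `L²(Y)`, where `ũ = J u` is the extension of `u`. -/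
noncomputable def meanFree : L2 D →L[ℂ] L2 (unitCell d) :=
  J.toContinuousLinearMap - ((innerSL ℂ (cosLp (0 : Fin d → ℕ))).smulRight
    (cosLp (0 : Fin d → ℕ))) ∘L J.toContinuousLinearMap

theorem meanFree_apply (u : L2 D) : meanFree J u =
    J u - (inner ℂ (cosLp (0 : Fin d → ℕ)) (J u) : ℂ) • cosLp (0 : Fin d → ℕ) := by
  simp [meanFree]

theorem meanFree_mem_L20 (u : L2 D) : meanFree J u ∈ L20 d := by
  rw [mem_L20_iff, meanFree_apply, inner_sub_right, inner_smul_right, inner_cosLp_zero_self,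
    mul_one, sub_self]

/-- The pair of `ũ - (∫_D ũ) 1_Y` and its gradient. -/
noncomputable def meanFreeJet (q : Jet D) : Jet (unitCell d) :=
  (meanFree J q.1, fun i => J (q.2 i))

theorem meanFreeJet_eq (q : Jet D) : meanFreeJet J q = mapJet J.toContinuousLinearMap q -
    (inner ℂ (cosLp (0 : Fin d → ℕ)) (J q.1) : ℂ) • cosJet 0 := by
  refine Prod.ext (meanFree_apply J q.1) (funext fun i => ?_)
  simp [meanFreeJet, mapJet, cosJet]

theorem energyForm_meanFreeJet (p q : Jet D) :
    energyForm (meanFreeJet J p) (meanFreeJet J q) = energyForm p q := by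
  simp only [energyForm_eq_sum_inner, meanFreeJet, J.inner_map_map]

theorem inner_cosLp_zero_extension
    (hJ : ∀ u, J u =ᵐ[volume.restrict (unitCell d)] D.indicator u)
    (hD : MeasurableSet D) (hDY : D ⊆ unitCell d) (u : L2 D) :
    inner ℂ (cosLp (0 : Fin d → ℕ)) (J u) = ∫ x in D, u x := by
  rw [inner_cosLp_zero, integral_congr_ae (hJ u), integral_indicator_of_subset hD hDY]

theorem meanFreeJet_mem_meanZeroH1
    (hJ : ∀ u, J u =ᵐ[volume.restrict (unitCell d)] D.indicator u)
    (hD : MeasurableSet D) {q : Jet D} (hq : q ∈ H10 D) :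
    meanFreeJet J q ∈ meanZeroH1 d := by
  refine ⟨?_, meanFree_mem_L20 J q.1⟩
  obtain ⟨V, hV, -⟩ := exists_submodule_H1 (unitCell d)
  rw [meanFreeJet_eq, ← hV]
  refine V.sub_mem ?_ (V.smul_mem _ ?_)
  · rw [← SetLike.mem_coe, hV]
    exact mapJet_mem_H1 hD _ hJ hq
  · rw [← SetLike.mem_coe, hV]
    exact cosJet_mem_H1 0

theorem coeFn_meanFree
    (hJ : ∀ u, J u =ᵐ[volume.restrict (unitCell d)] D.indicator u)
    (hD : MeasurableSet D) (hDY : D ⊆ unitCell d) (u : L2 D) :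
    meanFree J u =ᵐ[volume.restrict (unitCell d)]
      fun x => D.indicator u x - ∫ y in D, u y := by
  rw [meanFree_apply]
  filter_upwards [Lp.coeFn_sub (J u)
    ((inner ℂ (cosLp (0 : Fin d → ℕ)) (J u) : ℂ) • cosLp (0 : Fin d → ℕ)), hJ u,
    Lp.coeFn_smul (inner ℂ (cosLp (0 : Fin d → ℕ)) (J u) : ℂ) (cosLp (0 : Fin d → ℕ)),
    coeFn_cosLp_zero] with x h1 h2 h3 h4
  rw [h1, Pi.sub_apply, h2, h3, Pi.smul_apply, h4,
    inner_cosLp_zero_extension J hJ hD hDY, smul_eq_mul, mul_one]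

theorem mem_W2_iff
    (hJ : ∀ u, J u =ᵐ[volume.restrict (unitCell d)] D.indicator u)
    (hD : MeasurableSet D) (hDY : D ⊆ unitCell d) (p : Jet (unitCell d)) :
    p ∈ W2 D ↔ ∃ q ∈ H10 D, p = meanFreeJet J q := by
  refine exists_congr fun q => and_congr_right fun _ => ⟨fun h => ?_, ?_⟩
  · exact Prod.ext (Lp.ext (h.1.trans (coeFn_meanFree J hJ hD hDY q.1).symm))
      (funext fun i => Lp.ext ((h.2 i).trans (hJ _).symm))
  · rintro rfl
    exact ⟨coeFn_meanFree J hJ hD hDY q.1, fun i => hJ _⟩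

/-- `u ↦ ũ - (∫_D ũ) 1_Y` as an operator from `L²(D)` to `L²₀(Y)`. -/
noncomputable def toMeanZero : L2 D →L[ℂ] L20 d :=
  (meanFree J).codRestrict (L20 d) (meanFree_mem_L20 J)

/-- Restriction to `D` as an operator from `L²₀(Y)` to `L²(D)`: the adjoint of the extension. -/
noncomputable def restrictMeanZero : L20 d →L[ℂ] L2 D :=
  J.toContinuousLinearMap.adjoint ∘L (L20 d).subtypeL

/-- The constant function `1` on `D`. -/
noncomputable def oneOn : L2 D := J.toContinuousLinearMap.adjoint (cosLp (0 : Fin d → ℕ))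

theorem inner_meanFree (u : L2 D) (f : L20 d) :
    inner ℂ (meanFree J u) (f : L2 (unitCell d)) = inner ℂ u (restrictMeanZero J f) := by
  rw [meanFree_apply, inner_sub_left, inner_smul_left, (mem_L20_iff _).1 f.2, mul_zero, sub_zero]
  exact (ContinuousLinearMap.adjoint_inner_right J.toContinuousLinearMap u _).symm

theorem inner_oneOn (u : L2 D) :
    inner ℂ (oneOn J) u = inner ℂ (cosLp (0 : Fin d → ℕ)) (J u) :=
  ContinuousLinearMap.adjoint_inner_left J.toContinuousLinearMap u _

theorem restrictMeanZero_toMeanZero (u : L2 D) :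
    restrictMeanZero J (toMeanZero J u) = u - (inner ℂ (oneOn J) u : ℂ) • oneOn J := by
  have hJJ : J.toContinuousLinearMap.adjoint (J u) = u := by
    refine ext_inner_left ℂ fun v => ?_
    rw [ContinuousLinearMap.adjoint_inner_right]
    exact J.inner_map_map v u
  change J.toContinuousLinearMap.adjoint (meanFree J u) = _
  rw [meanFree_apply, map_sub, map_smul, hJJ, inner_oneOn]
  rfl

/-- The projection of `(-Δ_N)⁻¹ f` onto `W₂` comes from the solution of the Dirichlet problem on
`D` with the restriction of `f` to `D` as right hand side: test functions from `W₂` only see the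
scalar products of `f` with functions extended from `D`. -/
theorem isLimitOperator_iff
    (hJ : ∀ u, J u =ᵐ[volume.restrict (unitCell d)] D.indicator u)
    (hd : 1 ≤ d) (hD : MeasurableSet D) (hDY : D ⊆ unitCell d)
    {G : L2 D →L[ℂ] L2 D} (hG : IsDirichletResolvent D G) (A : L20 d →L[ℂ] L20 d) :
    IsLimitOperator D A ↔ A = toMeanZero J ∘L G ∘L restrictMeanZero J := by
  -- The projections are characterized by the weak Dirichlet problem.
  have key : ∀ (f : L20 d) (w : Jet (unitCell d)) (q : Jet D), IsNeumannSolution f w →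
      q ∈ H10 D → (IsProjectionW2 D w (meanFreeJet J q) ↔
        ∀ v ∈ H10 D, energyForm q v = l2Form (restrictMeanZero J f) v.1) := by
    intro f w q hw hq
    have hwv : ∀ v ∈ H10 D, energyForm (w - meanFreeJet J q) (meanFreeJet J v) =
        l2Form (restrictMeanZero J f) v.1 - energyForm q v := fun v hv => by
      rw [energyForm_sub_left, hw.2 _ (meanFreeJet_mem_meanZeroH1 J hJ hD hv),
        energyForm_meanFreeJet, l2Form_eq_inner, l2Form_eq_inner, ← inner_meanFree]
      rfl
    constructor
    · intro h v hv
      have h0 := h.2 _ ((mem_W2_iff J hJ hD hDY _).2 ⟨v, hv, rfl⟩)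
      rw [hwv v hv] at h0
      exact (sub_eq_zero.1 h0).symm
    · intro h
      refine ⟨(mem_W2_iff J hJ hD hDY _).2 ⟨q, hq, rfl⟩, fun v' hv' => ?_⟩
      obtain ⟨v, hv, rfl⟩ := (mem_W2_iff J hJ hD hDY _).1 hv'
      rw [hwv v hv, h v hv, sub_self]
  constructor
  · intro hA
    ext1 f
    obtain ⟨w, p, hw, hp, hpA⟩ := hA f
    obtain ⟨q, hq, rfl⟩ := (mem_W2_iff J hJ hD hDY _).1 hp.1
    obtain ⟨q', hq', hqG, hqv⟩ := hG (restrictMeanZero J f)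
    have hqq := fst_eq_of_energyForm_eq hd hDY hq hq' fun v hv => by
      rw [(key f w q hw hq).1 hp v hv, hqv v hv]
    refine Subtype.ext (hpA.symm.trans ?_)
    change meanFree J q.1 = meanFree J (G (restrictMeanZero J f))
    rw [hqq, hqG]
  · rintro rfl f
    obtain ⟨w, hw⟩ := exists_isNeumannSolution f
    obtain ⟨q, hq, hqG, hqv⟩ := hG (restrictMeanZero J f)
    refine ⟨w, meanFreeJet J q, hw, (key f w q hw hq).2 hqv, ?_⟩
    change meanFree J q.1 = meanFree J (G (restrictMeanZero J f))
    rw [hqG]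

variable {G : L2 D →L[ℂ] L2 D}

theorem isCompactOperator_limit (hc : IsCompactOperator G) :
    IsCompactOperator (toMeanZero J ∘L G ∘L restrictMeanZero J) :=
  (hc.comp_clm (restrictMeanZero J)).clm_comp (toMeanZero J)

theorem not_finiteDimensional_L20 (hd : 1 ≤ d) : ¬ FiniteDimensional ℂ (L20 d) := by
  intro hfin
  have hne : (unitCell d).Nonempty := ⟨WithLp.toLp 2 fun _ => 1 / 2, fun i => by
    change (0 : ℝ) < 1 / 2 ∧ (1 / 2 : ℝ) < 1
    norm_num⟩
  refine not_finiteDimensional_L2 hd (isOpen_unitCell d) hne subset_rfl ?_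
  let T : (L20 d × ℂ) →ₗ[ℂ] L2 (unitCell d) :=
    (L20 d).subtype.coprod (LinearMap.toSpanSingleton ℂ _ (cosLp (0 : Fin d → ℕ)))
  refine Module.Finite.of_surjective T fun u => ?_
  let m : ℂ := inner ℂ (cosLp (0 : Fin d → ℕ)) u
  have hmem : u - m • cosLp (0 : Fin d → ℕ) ∈ L20 d := by
    rw [mem_L20_iff, inner_sub_right, inner_smul_right, inner_cosLp_zero_self, mul_one, sub_self]
  exact ⟨(⟨_, hmem⟩, m), by simp [T]⟩

/-- A compact operator on an infinite dimensional Banach space is not invertible. -/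
theorem zero_mem_spectrum_of_isCompactOperator {X : Type*} [NormedAddCommGroup X]
    [NormedSpace ℂ X] [CompleteSpace X] (hX : ¬ FiniteDimensional ℂ X) {A : X →L[ℂ] X}
    (hA : IsCompactOperator A) : (0 : ℂ) ∈ spectrum ℂ A := by
  rw [spectrum.zero_mem_iff]
  rintro ⟨u, rfl⟩
  refine hX (FiniteDimensional.of_isCompactOperator_id (𝕜 := ℂ) ?_)
  have h := hA.comp_clm (↑u⁻¹ : X →L[ℂ] X)
  have he : (⇑(↑u : X →L[ℂ] X) ∘ ⇑(↑u⁻¹ : X →L[ℂ] X)) = id := by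
    ext x
    exact congrArg (fun T : X →L[ℂ] X => T x) u.mul_inv
  rwa [he] at h

/-- The nonzero spectrum of `A = E G R` is the nonzero point spectrum of
`R E G`, a rank one perturbation of `G`. -/
theorem mem_spectrum_limit_iff (hc : IsCompactOperator G) {z : ℂ} (hz : z ≠ 0) :
    z ∈ spectrum ℂ (toMeanZero J ∘L G ∘L restrictMeanZero J) ↔
      ∃ g : L2 D, g ≠ 0 ∧ G g - (inner ℂ (oneOn J) (G g) : ℂ) • oneOn J = z • g := by
  have : CompleteSpace (L20 d) := (isClosed_L20 d).completeSpace_coe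
  rw [← (isCompactOperator_limit J hc).hasEigenvalue_iff_mem_spectrum hz]
  constructor
  · intro h
    obtain ⟨f, hf⟩ := h.exists_hasEigenvector
    have hAf : toMeanZero J (G (restrictMeanZero J f)) = z • f := hf.apply_eq_smul
    refine ⟨restrictMeanZero J f, fun h0 => ?_, ?_⟩
    · rw [h0, map_zero, map_zero] at hAf
      exact (smul_ne_zero hz hf.2) hAf.symm
    · rw [← restrictMeanZero_toMeanZero, hAf, map_smul]
  · rintro ⟨g, hg, he⟩
    rw [← restrictMeanZero_toMeanZero] at he
    refine Module.End.hasEigenvalue_of_hasEigenvector (x := toMeanZero J (G g)) ⟨?_, fun h0 => ?_⟩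
    · rw [Module.End.mem_eigenspace_iff]
      change toMeanZero J (G (restrictMeanZero J (toMeanZero J (G g)))) = _
      rw [he, map_smul, map_smul]
    · rw [h0, map_zero] at he
      exact (smul_ne_zero hz hg) he.symm

/-- The nonzero elements of the spectrum are positive, because `A = E G E*`. -/
theorem exists_pos_of_mem_spectrum_limit (hc : IsCompactOperator G)
    (hG : IsDirichletResolvent D G) {z : ℂ} (hz : z ≠ 0)
    (h : z ∈ spectrum ℂ (toMeanZero J ∘L G ∘L restrictMeanZero J)) :
    ∃ ν : ℝ, 0 < ν ∧ z = ((ν⁻¹ : ℝ) : ℂ) := by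
  have : CompleteSpace (L20 d) := (isClosed_L20 d).completeSpace_coe
  rw [← (isCompactOperator_limit J hc).hasEigenvalue_iff_mem_spectrum hz] at h
  obtain ⟨f, hf⟩ := h.exists_hasEigenvector
  have hAf : toMeanZero J (G (restrictMeanZero J f)) = z • f := hf.apply_eq_smul
  have h1 : inner ℂ (meanFree J (G (restrictMeanZero J f))) (f : L2 (unitCell d)) =
      conj z * inner ℂ (f : L2 (unitCell d)) (f : L2 (unitCell d)) := by
    have := congrArg (Subtype.val) hAf
    change meanFree J (G (restrictMeanZero J f)) = z • (f : L2 (unitCell d)) at this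
    rw [this, inner_smul_left]
  obtain ⟨r, hr, hrf⟩ := hG.exists_inner_eq (restrictMeanZero J f)
  have hf0 : (f : L2 (unitCell d)) ≠ 0 := fun h0 => hf.2 (Subtype.ext h0)
  rw [inner_meanFree, ← inner_conj_symm, hrf, Complex.conj_ofReal,
    inner_self_eq_norm_sq_to_K] at h1
  have hn : (0 : ℝ) < ‖(f : L2 (unitCell d))‖ ^ 2 := by positivity
  have hz' : conj z = ((r / ‖(f : L2 (unitCell d))‖ ^ 2 : ℝ) : ℂ) := by
    rw [Complex.ofReal_div, eq_div_iff (Complex.ofReal_ne_zero.2 hn.ne'), h1]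
    simp
  have hz'' : z = ((r / ‖(f : L2 (unitCell d))‖ ^ 2 : ℝ) : ℂ) := by
    rw [← Complex.conj_conj z, hz', Complex.conj_ofReal]
  have hr0 : r ≠ 0 := fun h0 => hz (by rw [hz'', h0]; simp)
  refine ⟨(r / ‖(f : L2 (unitCell d))‖ ^ 2)⁻¹, ?_, by rw [inv_inv]; exact hz''⟩
  have : 0 < r := lt_of_le_of_ne hr hr0.symm
  positivity

end LimitOperator

/-! ### The spectrum -/

theorem meanOn_eq_inner_oneOn {d : ℕ} {D : Set (EuclideanSpace ℝ (Fin d))}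
    (J : L2 D →ₗᵢ[ℂ] L2 (unitCell d))
    (hJ : ∀ u, J u =ᵐ[volume.restrict (unitCell d)] D.indicator u) (hD : MeasurableSet D)
    (hDY : D ⊆ unitCell d) (ψ : L2 D) : meanOn ψ = inner ℂ (oneOn J) ψ := by
  rw [inner_oneOn, inner_cosLp_zero_extension J hJ hD hDY, meanOn]

theorem pos_of_smul_eq {d : ℕ} {D : Set (EuclideanSpace ℝ (Fin d))} {G : L2 D →L[ℂ] L2 D}
    (hG : IsDirichletResolvent D G) {t : ℝ} {ψ : L2 D} (hψ : ψ ≠ 0)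
    (h : (t : ℂ) • G ψ = ψ) : 0 < t := by
  obtain ⟨r, hr, hrψ⟩ := hG.exists_inner_eq ψ
  have h1 : inner ℂ ψ ((t : ℂ) • G ψ) = inner ℂ ψ ψ := by rw [h]
  rw [inner_smul_right, hrψ, inner_self_eq_norm_sq_to_K] at h1
  have h2 : t * r = ‖ψ‖ ^ 2 := by
    refine Complex.ofReal_injective ?_
    rw [Complex.ofReal_mul, h1]
    simp
  have h3 : 0 < t * r := by
    rw [h2]
    positivity
  exact pos_of_mul_pos_left h3 hr

theorem mainTheorem8 (d : ℕ) (hd : 1 ≤ d) (D : Set (EuclideanSpace ℝ (Fin d)))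
    (hDopen : IsOpen D) (hDne : D.Nonempty) (hDY : D ⊆ unitCell d) :
    (∃! A : L20 d →L[ℂ] L20 d, IsLimitOperator D A) ∧
    (∃ (ψ : HilbertBasis ℕ ℂ (L2 D)) (δ : ℕ → ℝ), IsDirichletEigenbasis D ψ δ) ∧
    ∀ A : L20 d →L[ℂ] L20 d, IsLimitOperator D A →
      ∀ (ψ : HilbertBasis ℕ ℂ (L2 D)) (δ : ℕ → ℝ), IsDirichletEigenbasis D ψ δ →
        spectrum ℂ A =
          {0} ∪ (reciprocals (meanZeroEigenvalues D) ∪ reciprocals (spectralRoots ψ δ)) := by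
  have hD := hDopen.measurableSet
  obtain ⟨G, hc, hs, hG⟩ := exists_dirichletResolvent hd hDopen hDY
  let J : L2 D →ₗᵢ[ℂ] L2 (unitCell d) := extendZero hD hDY
  have hJ : ∀ u, J u =ᵐ[volume.restrict (unitCell d)] D.indicator u := coeFn_extendZero hD hDY
  have hlim := isLimitOperator_iff J hJ hd hD hDY hG
  refine ⟨⟨_, (hlim _).2 rfl, fun A hA => (hlim A).1 hA⟩,
    exists_isDirichletEigenbasis hd hDopen hDne hDY, ?_⟩
  intro A hA ψ δ hψ
  rw [(hlim A).1 hA]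
  have hcA := isCompactOperator_limit J hc
  have hδ : ∀ i, (δ i : ℂ) • G (ψ i) = ψ i := fun i =>
    ((isDirichletEigenfunction_iff hd hDY hG).1 (hψ i)).2
  have hmean := meanOn_eq_inner_oneOn J hJ hD hDY
  have hroots : ∀ ν : ℝ, ν ∈ spectralRoots ψ δ ↔ 0 < ν ∧
      ((∀ i, inner ℂ (oneOn J) (ψ i) ≠ 0 → ν ≠ δ i) ∧
        ν * ∑' i : {i : ℕ // inner ℂ (oneOn J) (ψ i) ≠ 0},
          ‖inner ℂ (oneOn J) (ψ i)‖ ^ 2 / (ν - δ i) - 1 = 0) := fun ν => by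
    let P : (ℕ → ℂ) → Prop := fun β => 0 < ν ∧ ((∀ i, β i ≠ 0 → ν ≠ δ i) ∧
      ν * ∑' i : {i : ℕ // β i ≠ 0}, ‖β i‖ ^ 2 / (ν - δ i) - 1 = 0)
    exact iff_of_eq (congrArg P (funext fun i => hmean (ψ i)))
  have hevs : ∀ t : ℝ, t ∈ meanZeroEigenvalues D ↔
      ∃ x : L2 D, x ≠ 0 ∧ (t : ℂ) • G x = x ∧ inner ℂ (oneOn J) x = 0 := fun t => by
    refine exists_congr fun x => ?_
    rw [isDirichletEigenfunction_iff hd hDY hG, hmean, and_assoc]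
  have hiff : ∀ ν : ℝ, 0 < ν →
      (((ν⁻¹ : ℝ) : ℂ) ∈ spectrum ℂ (toMeanZero J ∘L G ∘L restrictMeanZero J) ↔
        ν ∈ meanZeroEigenvalues D ∨ ν ∈ spectralRoots ψ δ) := fun ν hν => by
    rw [mem_spectrum_limit_iff J hc (Complex.ofReal_ne_zero.2 (inv_ne_zero hν.ne')),
      exists_rankOne_eigenvector_iff hs hc hδ _ hν, hevs, hroots]
    simp only [hν, true_and]
  ext z
  constructor
  · intro hz
    by_cases hz0 : z = 0
    · exact Or.inl hz0
    · obtain ⟨ν, hν, rfl⟩ := exists_pos_of_mem_spectrum_limit J hc hG hz0 hz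
      exact Or.inr (((hiff ν hν).1 hz).imp (fun h => ⟨ν, h, rfl⟩) fun h => ⟨ν, h, rfl⟩)
  · rintro (rfl | ⟨t, ht, rfl⟩ | ⟨ν, hν, rfl⟩)
    · have : CompleteSpace (L20 d) := (isClosed_L20 d).completeSpace_coe
      exact zero_mem_spectrum_of_isCompactOperator (not_finiteDimensional_L20 hd) hcA
    · obtain ⟨x, hx, hGx, -⟩ := (hevs t).1 ht
      exact (hiff t (pos_of_smul_eq hG hx hGx)).2 (Or.inl ht)
    · exact (hiff ν hν.1).2 (Or.inr hν)
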